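/- **Setting.** Let $Q\subset\mathbb R^D$ be open (the configuration space, with coordinates $q=(q^1,\dots,q^D)$), let $\mathbb P_L=TQ=Q\times\mathbb R^D$ be the Lagrangian phase space with coordinates $u=(q,v)$, and let $L\colon\mathbb P_L\to\mathbb R$ be a smooth Lagrangian, with energy $E=v^a\partial L/\partial v^a-L$, one-form $\theta_L=(\partial L/\partial v^a)\,dq^a$, Lagrangian two-form $\Omega_L=-d\theta_L$ and $M_{ab}=\partial^2L/\partial v^a\partial v^b$. Assume that $M_{ab}$ and $\Omega_L$ have constant rank on $\mathbb P_L$. Fix $t_1<t_2$ and let $S[q]=\int_{t_1}^{t_2}L(q,\dot q)\,dt$ be the action of a smooth path $q(t)$ in $Q$. All vector fields are smooth on $\mathbb P_L$. * $\mathbf g_L=\rho(q,\dot q)\cdot\partial/\partial q$ generates a *generalized Lie symmetry of $S$* if along every smooth path in $Q$ the variation $\delta S=\int_{t_1}^{t_2}\big(\rho\cdot\tfrac{\partial L}{\partial q}+\dot\rho\cdot\tfrac{\partial L}{\partial\dot q}\big)dt$ (with $\dot\rho=d\rho/dt$ along the path) equals the end point term $\big[\rho\cdot\tfrac{\partial L}{\partial\dot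 q}\big]_{t_1}^{t_2}$; that is, $\int_{t_1}^{t_2}\rho\cdot\big(\tfrac{\partial L}{\partial q}-\tfrac{d}{dt}\tfrac{\partial L}{\partial\dot q}\big)dt=0$ along every path. * $\mathcal G$ is the space of vertical vector fields $z\cdot\partial/\partial v$ with $z\in\ker M$; $\overline{\ker\Omega_L}$ is the space of vector fields $P$ with $i_P\Omega_L=0$ and $[G,P]$ vertical for all $G\in\mathcal G$; $[P]$ denotes the class of $P$ in $\overline{\ker\Omega_L}/\mathcal G$. * The first-order constraint function of $P\in\overline{\ker\Omega_L}$ is $\gamma_P=\langle dE|P\rangle$, and $\mathbb P_L^{[1]}$ is the set of points where $dE$ vanishes on $\ker\Omega_L$. $\mathcal S\mathrm{ol}$ is the set of vector fields $X$ with $i_X\Omega_L=dE$ on $\mathbb P_L^{[1]}$; for such $X$ put $\beta[X]=dE-i_X\Omega_L$ (so $\langle\beta[X]|P\rangle=\gamma_P$). $\overline{\mathcal S\mathrm{ol}}$ is the set of $X\in\mathcal S\mathrm{ol}$ with $[G,X]$ vertical on $\mathbb P_L^{[1]}$ for all $G\in\mathcal G$. * $\mathcal S\mathrm{ym}\mathcal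 L=\{[P]\in\overline{\ker\Omega_L}/\mathcal G:\ \gamma_P=0\text{ on }\mathbb P_L\}$, and, for $X\in\mathcal S\mathrm{ol}$, $\mathcal S\mathrm{ym}=\mathcal S\mathrm{ym}[X]=\{[P]:\ \mathfrak L_P\beta[X]=d\langle\beta[X]|P\rangle\text{ on }\mathbb P_L^{[1]}\}$. * $\mathrm{Gr}_{\mathcal S\mathrm{ym}\mathcal L}$ and $\mathrm{Gr}_{\mathcal S\mathrm{ym}}$ are the groups of transformations of $\mathbb P_L$ generated by the one-parameter groups (flows) of the complete vector fields $P$ with $[P]\in\mathcal S\mathrm{ym}\mathcal L$, respectively $[P]\in\mathcal S\mathrm{ym}$. * $\mathcal O_{EL}(u_0)$ is the set of curves $u\colon[t_0,\infty)\to\mathbb P_L$ with $u(t_0)=u_0$ and $\dot u=X(u)$ for some $X\in\overline{\mathcal S\mathrm{ol}}$. **Theorem 3.** 1. ($\mathcal S\mathrm{ym}\mathcal L$ is a Lie algebra.) $\mathcal G\subset\overline{\ker\Omega_L}$ and $[\overline{\ker\Omega_L},\mathcal G]\subset\mathcal G$; and if $[P_1],[P_2]\in\mathcal S\mathrm{ym}\mathcal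 L$, then the Lie bracket of $P_1$ and $P_2$ again represents an element of $\mathcal S\mathrm{ym}\mathcal L$. 2. ($\mathrm{Gr}_{\mathcal S\mathrm{ym}\mathcal L}$ is the group of symmetry transformations of $S$.) For $P=\rho\cdot\partial/\partial q+\eta\cdot\partial/\partial v\in\overline{\ker\Omega_L}$, one has $[P]\in\mathcal S\mathrm{ym}\mathcal L$ if and only if $\rho\cdot\partial/\partial q$ generates a generalized Lie symmetry of $S$. Conversely, every generalized Lie symmetry $\rho(q,\dot q)\cdot\partial/\partial q$ of $S$ with $G\rho=0$ for all $G\in\mathcal G$ arises in this way from exactly one element of $\mathcal S\mathrm{ym}\mathcal L$. Hence $\mathrm{Gr}_{\mathcal S\mathrm{ym}\mathcal L}$ equals the group generated by the one-parameter groups of the complete $P=\rho\cdot\partial/\partial q+\eta\cdot\partial/\partial v\in\overline{\ker\Omega_L}$ for which $\rho\cdot\partial/\partial q$ generates a generalized Lie symmetry of $S$. Every $\sigma\in\mathrm{Gr}_{\mathcal S\mathrm{ym}\mathcal L}$ leaves the action invariant up to end point terms: there is a function $f$ on $\mathbb P_L$ such that, for every smooth path $w$ in $\mathbb P_L$, $A[\sigma\circ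 w]=A[w]+f(w(t_2))-f(w(t_1))$, where $A[w]=\int_{t_1}^{t_2}\big(\theta_L(\dot w)-E(w)\big)dt$ (and $A[(q,\dot q)]=S[q]$). 3. (Lie subgroup.) For every $X\in\mathcal S\mathrm{ol}$, $\mathcal S\mathrm{ym}\mathcal L\subset\mathcal S\mathrm{ym}[X]$ and $\mathrm{Gr}_{\mathcal S\mathrm{ym}\mathcal L}$ is a subgroup of $\mathrm{Gr}_{\mathcal S\mathrm{ym}[X]}$. 4. (Symmetry of the Euler–Lagrange flows.) Every $\sigma\in\mathrm{Gr}_{\mathcal S\mathrm{ym}\mathcal L}$ maps $\mathcal O_{EL}(u_0)$ onto $\mathcal O_{EL}(\sigma(u_0))$, for all $t_0$ and all $u_0\in\mathbb P_L$. -/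

import Mathlib

open Set MeasureTheory
open scoped ContDiff Topology

noncomputable section

namespace LagrangianSymmetry

/-- The coordinate space `ℝ^D`; a configuration space is an open subset of it. -/
abbrev Config (D : ℕ) := EuclideanSpace ℝ (Fin D)

/-- The space of pairs `u = (q, v)` of coordinates and velocities. -/
abbrev Phase (D : ℕ) := Config D × Config D

/-- Vector fields, in coordinates: `X u = (X^q u, X^v u)` stands for `X^q · ∂/∂q + X^v · ∂/∂v`.
Only the values on the phase space matter. -/
abbrev VF (D : ℕ) := Phase D → Phase D

/-- The Lagrangian phase space `P_L = TQ = Q × ℝ^D`. -/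
def phaseSpace {D : ℕ} (Q : TopologicalSpace.Opens (Config D)) : Set (Phase D) :=
  {u | u.1 ∈ Q}

theorem isOpen_phaseSpace {D : ℕ} (Q : TopologicalSpace.Opens (Config D)) :
    IsOpen (phaseSpace Q) :=
  Q.isOpen.preimage continuous_fst

/-- The momentum `∂L/∂v`, as a covector on `ℝ^D`. -/
def momentum {D : ℕ} (L : Phase D → ℝ) (u : Phase D) : Config D →L[ℝ] ℝ :=
  (fderiv ℝ L u).comp (ContinuousLinearMap.inr ℝ (Config D) (Config D))

/-- The matrix `M_ab = ∂²L / ∂v^a ∂v^b`, as a map from vectors to covectors. -/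
def hessian {D : ℕ} (L : Phase D → ℝ) (u : Phase D) : Config D →L[ℝ] Config D →L[ℝ] ℝ :=
  (fderiv ℝ (momentum L) u).comp (ContinuousLinearMap.inr ℝ (Config D) (Config D))

/-- The energy `E = v · ∂L/∂v - L`. -/
def energy {D : ℕ} (L : Phase D → ℝ) (u : Phase D) : ℝ := momentum L u u.2 - L u

/-- The one-form `θ_L = (∂L/∂v^a) dq^a`. -/
def theta {D : ℕ} (L : Phase D → ℝ) (u : Phase D) : Phase D →L[ℝ] ℝ :=
  (momentum L u).comp (ContinuousLinearMap.fst ℝ (Config D) (Config D))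

/-- The Lagrangian two-form `Ω_L = - dθ_L`, as the map `X ↦ i_X Ω_L`:
`Ω_L (X, Y) = - (Dθ_L (X) (Y) - Dθ_L (Y) (X))`. -/
def omega {D : ℕ} (L : Phase D → ℝ) (u : Phase D) : Phase D →L[ℝ] Phase D →L[ℝ] ℝ :=
  (fderiv ℝ (theta L) u).flip - fderiv ℝ (theta L) u

/-- `M_ab` has constant rank on the phase space. -/
def HessianConstantRank {D : ℕ} (Q : TopologicalSpace.Opens (Config D)) (L : Phase D → ℝ) : Prop :=
  ∃ r : ℕ, ∀ u ∈ phaseSpace Q,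
    Module.finrank ℝ (LinearMap.range (hessian L u : Config D →ₗ[ℝ] Config D →L[ℝ] ℝ)) = r

/-- `Ω_L` has constant rank on the phase space. -/
def OmegaConstantRank {D : ℕ} (Q : TopologicalSpace.Opens (Config D)) (L : Phase D → ℝ) : Prop :=
  ∃ r : ℕ, ∀ u ∈ phaseSpace Q,
    Module.finrank ℝ (LinearMap.range (omega L u : Phase D →ₗ[ℝ] Phase D →L[ℝ] ℝ)) = r

/-! ### Generators on the phase space -/

/-- `𝒢`: the smooth vertical vector fields `z · ∂/∂v` with `z ∈ ker M`. -/
def gauge {D : ℕ} (Q : TopologicalSpace.Opens (Config D)) (L : Phase D → ℝ) :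
    Submodule ℝ (VF D) where
  carrier := {G | ContDiffOn ℝ ∞ G (phaseSpace Q) ∧
    ∀ u ∈ phaseSpace Q, (G u).1 = 0 ∧ hessian L u (G u).2 = 0}
  zero_mem' := ⟨contDiffOn_const, fun _ _ => by simp⟩
  add_mem' := fun {A B} hA hB => ⟨hA.1.add hB.1, fun u hu => by
    simp [(hA.2 u hu).1, (hA.2 u hu).2, (hB.2 u hu).1, (hB.2 u hu).2]⟩
  smul_mem' := fun c A hA => ⟨hA.1.const_smul c, fun u hu => by
    simp [(hA.2 u hu).1, (hA.2 u hu).2]⟩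

theorem differentiableAt_of_smooth {D : ℕ} {Q : TopologicalSpace.Opens (Config D)} {X : VF D}
    (hX : ContDiffOn ℝ ∞ X (phaseSpace Q)) {u : Phase D} (hu : u ∈ phaseSpace Q) :
    DifferentiableAt ℝ X u :=
  (hX.contDiffAt ((isOpen_phaseSpace Q).mem_nhds hu)).differentiableAt (by simp)

/-- The smooth vector fields `P` in the kernel of `Ω_L` for which `[G, P]` is vertical for every
`G ∈ 𝒢`. -/
def kerBar {D : ℕ} (Q : TopologicalSpace.Opens (Config D)) (L : Phase D → ℝ) :
    Submodule ℝ (VF D) where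
  carrier := {P | ContDiffOn ℝ ∞ P (phaseSpace Q) ∧
    (∀ u ∈ phaseSpace Q, omega L u (P u) = 0) ∧
    ∀ G ∈ gauge Q L, ∀ u ∈ phaseSpace Q, (VectorField.lieBracket ℝ G P u).1 = 0}
  zero_mem' := ⟨contDiffOn_const, fun _ _ => by simp, fun G _ u _ => by
    simp [VectorField.lieBracket]⟩
  add_mem' := fun {A B} hA hB => ⟨hA.1.add hB.1, fun u hu => by
      simp [hA.2.1 u hu, hB.2.1 u hu], fun G hG u hu => by
      rw [VectorField.lieBracket_add_right (differentiableAt_of_smooth hA.1 hu)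
        (differentiableAt_of_smooth hB.1 hu)]
      simp [hA.2.2 G hG u hu, hB.2.2 G hG u hu]⟩
  smul_mem' := fun c A hA => ⟨hA.1.const_smul c, fun u hu => by
      simp [hA.2.1 u hu], fun G hG u hu => by
      rw [VectorField.lieBracket_const_smul_right (differentiableAt_of_smooth hA.1 hu)]
      simp [hA.2.2 G hG u hu]⟩

/-- The quotient of `kerBar` by `𝒢`. -/
abbrev KerBarQuot {D : ℕ} (Q : TopologicalSpace.Opens (Config D)) (L : Phase D → ℝ) :=
  kerBar Q L ⧸ (gauge Q L).comap (kerBar Q L).subtype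

/-- The class `[P]` of `P` modulo `𝒢`. -/
def cls {D : ℕ} {Q : TopologicalSpace.Opens (Config D)} {L : Phase D → ℝ}
    (P : VF D) (hP : P ∈ kerBar Q L) : KerBarQuot Q L :=
  Submodule.Quotient.mk ⟨P, hP⟩

/-- The vector fields that represent the classes in `S`. -/
def representatives {D : ℕ} {Q : TopologicalSpace.Opens (Config D)} {L : Phase D → ℝ}
    (S : Set (KerBarQuot Q L)) : Set (VF D) :=
  {P | ∃ hP : P ∈ kerBar Q L, cls P hP ∈ S}

/-- The constraint one-form `β[X] = dE - i_X Ω_L`. -/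
def beta {D : ℕ} (L : Phase D → ℝ) (X : VF D) (u : Phase D) : Phase D →L[ℝ] ℝ :=
  fderiv ℝ (energy L) u - omega L u (X u)

/-- On the kernel of `Ω_L` the constraint one-form does not depend on `X`: it gives the first-order
constraint function `γ_P = ⟨β[X], P⟩ = P E`. -/
theorem beta_apply_of_mem_kerBar {D : ℕ} {Q : TopologicalSpace.Opens (Config D)}
    {L : Phase D → ℝ} (X : VF D) {P : VF D} (hP : P ∈ kerBar Q L) {u : Phase D}
    (hu : u ∈ phaseSpace Q) : beta L X u (P u) = fderiv ℝ (energy L) u (P u) := by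
  have h := congrArg (fun φ : Phase D →L[ℝ] ℝ => φ (X u)) (hP.2.1 u hu)
  simp only [omega, sub_apply, ContinuousLinearMap.flip_apply,
    zero_apply] at h
  simp only [beta, omega, sub_apply, ContinuousLinearMap.flip_apply]
  linarith

/-- `SymL`: the classes `[P]` whose first-order constraint function `γ_P = P E` vanishes identically
on the phase space. -/
def symL {D : ℕ} (Q : TopologicalSpace.Opens (Config D)) (L : Phase D → ℝ) :
    Submodule ℝ (KerBarQuot Q L) :=
  Submodule.map (Submodule.mkQ ((gauge Q L).comap (kerBar Q L).subtype))
    { carrier := {P | ∀ u ∈ phaseSpace Q, fderiv ℝ (energy L) u ((P : VF D) u) = 0}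
      zero_mem' := fun _ _ => by simp
      add_mem' := fun {A B} hA hB u hu => by simp [hA u hu, hB u hu]
      smul_mem' := fun c A hA u hu => by simp [hA u hu] }

/-- The first-order constraint set `P_L^[1]`: the points where all first-order constraint
functions vanish, that is, where `dE` vanishes on the kernel of `Ω_L`. -/
def constraintSet {D : ℕ} (Q : TopologicalSpace.Opens (Config D)) (L : Phase D → ℝ) :
    Set (Phase D) :=
  {u | u ∈ phaseSpace Q ∧ ∀ K : Phase D, omega L u K = 0 → fderiv ℝ (energy L) u K = 0}

/-- `Sol`: the smooth solutions of the energy equation `i_X Ω_L = dE` on `P_L^[1]`. -/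
def sol {D : ℕ} (Q : TopologicalSpace.Opens (Config D)) (L : Phase D → ℝ) : Set (VF D) :=
  {X | ContDiffOn ℝ ∞ X (phaseSpace Q) ∧
    ∀ u ∈ constraintSet Q L, omega L u (X u) = fderiv ℝ (energy L) u}

/-- The second-order Euler-Lagrange vector fields: the solutions `X` of the energy equation for
which `[G, X]` is vertical for every `G ∈ 𝒢`, where the energy equation holds. -/
def solBar {D : ℕ} (Q : TopologicalSpace.Opens (Config D)) (L : Phase D → ℝ) : Set (VF D) :=
  {X | X ∈ sol Q L ∧ ∀ G ∈ gauge Q L, ∀ u ∈ constraintSet Q L,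
    (VectorField.lieBracket ℝ G X u).1 = 0}

/-- The Lie derivative `𝔏_P α` of a one-form along a vector field, in coordinates. -/
def lieDerivForm {D : ℕ} (P : VF D) (α : Phase D → Phase D →L[ℝ] ℝ) (u : Phase D) :
    Phase D →L[ℝ] ℝ :=
  fderiv ℝ α u (P u) + (α u).comp (fderiv ℝ P u)

/-- `Sym`, for the constraint one-form of `X`: the classes `[P]` with `𝔏_P β = d⟨β, P⟩` on
`P_L^[1]` (for every representative). -/
def sym {D : ℕ} (Q : TopologicalSpace.Opens (Config D)) (L : Phase D → ℝ) (X : VF D) :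
    Set (KerBarQuot Q L) :=
  {c | ∀ (P : VF D) (hP : P ∈ kerBar Q L), cls P hP = c → ∀ u ∈ constraintSet Q L,
    lieDerivForm P (beta L X) u = fderiv ℝ (fun u' => beta L X u' (P u')) u}

/-! ### Groups generated by flows -/

/-- `Φ` is the (complete, smooth) flow of `X` on the phase space. -/
def IsFlow {D : ℕ} (Q : TopologicalSpace.Opens (Config D)) (X : VF D)
    (Φ : ℝ → Phase D → Phase D) : Prop :=
  ContDiffOn ℝ ∞ (fun p : ℝ × Phase D => Φ p.1 p.2) (univ ×ˢ phaseSpace Q) ∧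
  ∀ u ∈ phaseSpace Q, Φ 0 u = u ∧
    ∀ ε : ℝ, Φ ε u ∈ phaseSpace Q ∧ HasDerivAt (fun s => Φ s u) (X (Φ ε u)) ε

/-- The group of transformations of the phase space generated by the one-parameter groups of the
vector fields in `S`. -/
def flowGroup {D : ℕ} (Q : TopologicalSpace.Opens (Config D)) (S : Set (VF D)) :
    Subgroup (Equiv.Perm (phaseSpace Q)) :=
  Subgroup.closure {σ | ∃ X ∈ S, ∃ Φ, IsFlow Q X Φ ∧
    ∃ ε : ℝ, ∀ u : phaseSpace Q, (σ u : Phase D) = Φ ε u}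

/-- `Gr_SymL`. -/
def grSymL {D : ℕ} (Q : TopologicalSpace.Opens (Config D)) (L : Phase D → ℝ) :
    Subgroup (Equiv.Perm (phaseSpace Q)) :=
  flowGroup Q (representatives (symL Q L : Set (KerBarQuot Q L)))

/-- `Gr_Sym`, for the constraint one-form of `X`. -/
def grSym {D : ℕ} (Q : TopologicalSpace.Opens (Config D)) (L : Phase D → ℝ) (X : VF D) :
    Subgroup (Equiv.Perm (phaseSpace Q)) :=
  flowGroup Q (representatives (sym Q L X))

/-- The family `O_EL(u₀)` of Euler-Lagrange integral flows on `[t₀, ∞)` that start at `u₀`. -/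
def orbitsEL {D : ℕ} (Q : TopologicalSpace.Opens (Config D)) (L : Phase D → ℝ) (t₀ : ℝ)
    (u₀ : phaseSpace Q) : Set (ℝ → phaseSpace Q) :=
  {c | c t₀ = u₀ ∧ ∃ X ∈ solBar Q L, ∀ t ∈ Ici t₀,
    HasDerivWithinAt (fun s => (c s : Phase D)) (X (c t)) (Ici t₀) t}

/-! ### Symmetries of the action -/

/-- A path on `Q`. -/
def IsPath {D : ℕ} (Q : TopologicalSpace.Opens (Config D)) (q : ℝ → Config D) : Prop :=
  ContDiff ℝ ∞ q ∧ ∀ t, q t ∈ Q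

/-- The lift `t ↦ (q(t), q̇(t))` of a path. -/
def lift {D : ℕ} (q : ℝ → Config D) (t : ℝ) : Phase D := (q t, deriv q t)

/-- The action `S = ∫ L(q, q̇) dt` on `[t₁, t₂]`. -/
def action {D : ℕ} (L : Phase D → ℝ) (t₁ t₂ : ℝ) (q : ℝ → Config D) : ℝ :=
  ∫ t in t₁..t₂, L (lift q t)

/-- The variation `δS = ∫ pr g_L [L] dt` of the action along the path `q` for
`g_L = ρ(q, q̇) · ∂/∂q`, where `pr g_L [L] = ρ · ∂L/∂q + ρ̇ · ∂L/∂q̇`, with `ρ̇` the total time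
derivative along the path. -/
def deltaAction {D : ℕ} (L : Phase D → ℝ) (t₁ t₂ : ℝ) (ρ : Phase D → Config D)
    (q : ℝ → Config D) : ℝ :=
  ∫ t in t₁..t₂, fderiv ℝ L (lift q t) (ρ (lift q t), deriv (fun s => ρ (lift q s)) t)

/-- `g_L = ρ(q, q̇) · ∂/∂q` generates a generalized Lie symmetry of the action: along every path,
`δS` consists only of the end point terms of the integration by parts (which vanish once `ρ`
vanishes at both end points). In other words,
`∫ ρ · (∂L/∂q - d/dt ∂L/∂q̇) dt = 0` along every path. -/
def IsActionSymmetry {D : ℕ} (Q : TopologicalSpace.Opens (Config D)) (L : Phase D → ℝ)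
    (t₁ t₂ : ℝ) (ρ : Phase D → Config D) : Prop :=
  ContDiffOn ℝ ∞ ρ (phaseSpace Q) ∧
  ∀ q : ℝ → Config D, IsPath Q q →
    deltaAction L t₁ t₂ ρ q =
      momentum L (lift q t₂) (ρ (lift q t₂)) - momentum L (lift q t₁) (ρ (lift q t₁))

/-- The group of symmetry transformations of the action on the phase space: it is generated by the
one-parameter groups of the vector fields `ρ · ∂/∂q + η · ∂/∂v` in `kerBar` for which
`ρ · ∂/∂q` generates a generalized Lie symmetry of the action. -/
def actionSymmetryGroup {D : ℕ} (Q : TopologicalSpace.Opens (Config D)) (L : Phase D → ℝ)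
    (t₁ t₂ : ℝ) : Subgroup (Equiv.Perm (phaseSpace Q)) :=
  flowGroup Q {P | P ∈ kerBar Q L ∧ IsActionSymmetry Q L t₁ t₂ (fun u => (P u).1)}

/-- The action of a path on the phase space, `∫ (θ_L(u̇) - E(u)) dt`. -/
def phaseAction {D : ℕ} (L : Phase D → ℝ) (t₁ t₂ : ℝ) (w : ℝ → Phase D) : ℝ :=
  ∫ t in t₁..t₂, (theta L (w t) (deriv w t) - energy L (w t))

/-- On the lift of a path on `Q`, the action on the phase space is `S`. -/
theorem phaseAction_lift {D : ℕ} (L : Phase D → ℝ) (t₁ t₂ : ℝ) {q : ℝ → Config D}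
    (hq : ContDiff ℝ ∞ q) : phaseAction L t₁ t₂ (lift q) = action L t₁ t₂ q := by
  unfold phaseAction action
  congr 1
  funext t
  have h1 : DifferentiableAt ℝ q t := (hq.differentiable (by simp)) t
  have h2 : DifferentiableAt ℝ (deriv q) t :=
    ((contDiff_infty_iff_deriv.1 hq).2.differentiable (by simp)) t
  have h : deriv (lift q) t = (deriv q t, deriv (deriv q) t) :=
    (h1.hasDerivAt.prodMk h2.hasDerivAt).deriv
  rw [h]
  simp [theta, energy, lift]

end LagrangianSymmetry

end

/-!
The whole theorem rests on Cartan calculus for the closed two-form `Ω_L`. A vector field `P` with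
`i_P Ω_L = 0` satisfies `𝔏_P Ω_L = 0` (`lieDeriv_omega`), hence `𝔏_P (i_X Ω_L) = i_[P, X] Ω_L`
(`lieDerivForm_omega`), and `SymL` consists of the classes of those `P` that also preserve the
energy (`cls_mem_symL_iff`). With the Jacobi identity this gives the Lie algebra part.

For the action, integration by parts turns the symmetry condition into the vanishing of
`∫ ρ · (∂L/∂q - d/dt ∂L/∂q̇) dt` along all paths. Paths are defined for all times, so the
interval of integration can be translated; differentiating in the translation shows that the integrand takes
equal values at `t₁` and `t₂`. A path with an arbitrary second-order jet at `t₁` that is at rest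
at `t₂` then forces the integrand to vanish pointwise (`isActionSymmetry_iff_eulerLagrange`). On
the kernel of `Ω_L` this integrand is `-P E`. Conversely, a symmetry `ρ` that is constant along
the gauge directions lifts: the covector that `M η` has to equal annihilates `ker M`
(`liftObstruction_apply_eq_zero`), and since `M` is symmetric of constant rank it has a smooth
generalized inverse on the whole phase space, which yields a smooth `η` (`exists_hessian_eq`).

For the inclusion in `Sym`, the one-form `β[X]` vanishes on the constraint set `P_L^[1]`, so that
it suffices that `P` has integral curves inside this possibly singular set
(`exists_curve_in_constraintSet`). If `N` is a local smooth projection onto the kernel of `Ω_L`,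
which exists by constancy of the rank, then `P_L^[1]` is the zero set of `dE ∘ N`, and along `P`
this function satisfies a homogeneous linear differential equation; Grönwall's inequality
concludes.

The flow of a complete `P` preserves `Ω_L`, `E`, `P_L^[1]` and, by another Grönwall argument based
on `[P, 𝒢] ⊆ 𝒢`, the gauge directions (`IsFlow.fderiv_gauge`). Therefore it pushes second-order
Euler-Lagrange fields `X` forward to such fields (`IsFlow.pushforward_mem_solBar`): the bracket
`[G, X]` with a gauge field `G` is vertical and, by the previous paragraph applied to `G`, lies in
the kernel of `Ω_L` on `P_L^[1]`, so it is a gauge vector there, and these are preserved. Finally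
`𝔏_P θ_L = d (θ_L(P))` integrates along the flow to the end point terms of the action
(`IsFlow.phaseAction_comp`).
-/

noncomputable section

namespace LagrangianSymmetry

/-! ### The Lagrangian two-form and its kernel -/

section Calculus

variable {E F : Type*} [NormedAddCommGroup E] [NormedSpace ℝ E]
  [NormedAddCommGroup F] [NormedSpace ℝ F]

theorem two_le_smooth : (2 : WithTop ℕ∞) ≤ ∞ := by
  exact WithTop.coe_le_coe.2 le_top

theorem contDiffOn_fderiv {f : E → F} {s : Set E} (hs : IsOpen s) (hf : ContDiffOn ℝ ∞ f s) :
    ContDiffOn ℝ ∞ (fderiv ℝ f) s :=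
  hf.fderiv_of_isOpen hs (by simp)

theorem fderiv_fderiv_comm {f : E → F} {u : E} (hf : ContDiffAt ℝ ∞ f u) (x y : E) :
    fderiv ℝ (fderiv ℝ f) u x y = fderiv ℝ (fderiv ℝ f) u y x :=
  (hf.isSymmSndFDerivAt (by simpa using two_le_smooth)) x y

theorem contDiff_flip : ContDiff ℝ ∞ (fun B : E →L[ℝ] E →L[ℝ] F => B.flip) := by
  have h : IsBoundedLinearMap ℝ (fun B : E →L[ℝ] E →L[ℝ] F => B.flip) :=
    ⟨⟨fun A B => ContinuousLinearMap.flip_add A B,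
      fun c A => ContinuousLinearMap.flip_smul c A⟩, 1, one_pos,
      fun B => by rw [ContinuousLinearMap.opNorm_flip, one_mul]⟩
  exact h.contDiff
theorem contDiffOn_flip_sub {α : E → E →L[ℝ] E →L[ℝ] F} {s : Set E} (h : ContDiffOn ℝ ∞ α s) :
    ContDiffOn ℝ ∞ (fun u => (α u).flip - α u) s :=
   (contDiff_flip.comp_contDiffOn h).sub h
theorem fderiv_flip_sub {α : E → E →L[ℝ] E →L[ℝ] F} {u : E} (h : DifferentiableAt ℝ α u)
    (a x y : E) : fderiv ℝ (fun u => (α u).flip - α u) u a x y =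
      fderiv ℝ α u a y x - fderiv ℝ α u a x y := by
  have hd : DifferentiableAt ℝ (fun u => (α u).flip - α u) u :=
   ((contDiff_flip.differentiable (by simp)).differentiableAt.comp u h).sub h
  have h1 := (hd.hasFDerivAt.clm_apply (hasFDerivAt_const x u)).clm_apply (hasFDerivAt_const y u)
  have h2 := ((h.hasFDerivAt.clm_apply (hasFDerivAt_const y u)).clm_apply
    (hasFDerivAt_const x u)).sub
    ((h.hasFDerivAt.clm_apply (hasFDerivAt_const x u)).clm_apply (hasFDerivAt_const y u))
  have := congrArg (fun φ : E →L[ℝ] F => φ a) (h1.unique h2)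
  simpa using this

end Calculus

variable {D : ℕ} {Q : TopologicalSpace.Opens (Config D)} {L : Phase D → ℝ}

theorem smoothAt {F : Type*} [NormedAddCommGroup F] [NormedSpace ℝ F] {f : Phase D → F}
    (hf : ContDiffOn ℝ ∞ f (phaseSpace Q)) {u : Phase D} (hu : u ∈ phaseSpace Q) :
    ContDiffAt ℝ ∞ f u :=
  hf.contDiffAt ((isOpen_phaseSpace Q).mem_nhds hu)

theorem diffAt {F : Type*} [NormedAddCommGroup F] [NormedSpace ℝ F] {f : Phase D → F}
    (hf : ContDiffOn ℝ ∞ f (phaseSpace Q)) {u : Phase D} (hu : u ∈ phaseSpace Q) :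
    DifferentiableAt ℝ f u :=
  (smoothAt hf hu).differentiableAt (by simp)

theorem eventually_mem_phaseSpace {u : Phase D} (hu : u ∈ phaseSpace Q) :
    ∀ᶠ u' in 𝓝 u, u' ∈ phaseSpace Q :=
  (isOpen_phaseSpace Q).mem_nhds hu

theorem smooth_fderiv {F : Type*} [NormedAddCommGroup F] [NormedSpace ℝ F] {f : Phase D → F}
    (hf : ContDiffOn ℝ ∞ f (phaseSpace Q)) : ContDiffOn ℝ ∞ (fderiv ℝ f) (phaseSpace Q) :=
  contDiffOn_fderiv (isOpen_phaseSpace Q) hf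

theorem smooth_momentum (hL : ContDiffOn ℝ ∞ L (phaseSpace Q)) :
    ContDiffOn ℝ ∞ (momentum L) (phaseSpace Q) :=
  (smooth_fderiv hL).clm_comp contDiffOn_const

theorem smooth_theta (hL : ContDiffOn ℝ ∞ L (phaseSpace Q)) :
    ContDiffOn ℝ ∞ (theta L) (phaseSpace Q) :=
  (smooth_momentum hL).clm_comp contDiffOn_const

theorem smooth_hessian (hL : ContDiffOn ℝ ∞ L (phaseSpace Q)) :
    ContDiffOn ℝ ∞ (hessian L) (phaseSpace Q) :=
  (smooth_fderiv (smooth_momentum hL)).clm_comp contDiffOn_const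

theorem smooth_energy (hL : ContDiffOn ℝ ∞ L (phaseSpace Q)) :
    ContDiffOn ℝ ∞ (energy L) (phaseSpace Q) :=
  ((smooth_momentum hL).clm_apply contDiffOn_snd).sub hL

theorem smooth_omega (hL : ContDiffOn ℝ ∞ L (phaseSpace Q)) :
    ContDiffOn ℝ ∞ (omega L) (phaseSpace Q) :=
  contDiffOn_flip_sub (smooth_fderiv (smooth_theta hL))

theorem fderiv_momentum_apply (hL : ContDiffOn ℝ ∞ L (phaseSpace Q)) {u : Phase D}
    (hu : u ∈ phaseSpace Q) (x : Phase D) (b : Config D) :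
    fderiv ℝ (momentum L) u x b = fderiv ℝ (fderiv ℝ L) u x (0, b) := by
  have h := (diffAt (smooth_fderiv hL) hu).hasFDerivAt.clm_comp
    (hasFDerivAt_const (ContinuousLinearMap.inr ℝ (Config D) (Config D)) u)
  have h' : HasFDerivAt (momentum L) _ u := h
  rw [h'.fderiv]
  simp

theorem fderiv_theta_apply (hL : ContDiffOn ℝ ∞ L (phaseSpace Q)) {u : Phase D}
    (hu : u ∈ phaseSpace Q) (x y : Phase D) :
    fderiv ℝ (theta L) u x y = fderiv ℝ (momentum L) u x y.1 := by
  have h : HasFDerivAt (theta L) _ u := (diffAt (smooth_momentum hL) hu).hasFDerivAt.clm_comp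
    (hasFDerivAt_const (ContinuousLinearMap.fst ℝ (Config D) (Config D)) u)
  rw [h.fderiv]
  simp

theorem omega_apply (u x y : Phase D) :
    omega L u x y = fderiv ℝ (theta L) u y x - fderiv ℝ (theta L) u x y := rfl

theorem omega_apply_momentum (hL : ContDiffOn ℝ ∞ L (phaseSpace Q)) {u : Phase D}
    (hu : u ∈ phaseSpace Q) (x y : Phase D) :
    omega L u x y = fderiv ℝ (momentum L) u y x.1 - fderiv ℝ (momentum L) u x y.1 := by
  rw [omega_apply, fderiv_theta_apply hL hu, fderiv_theta_apply hL hu]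

theorem omega_swap (u x y : Phase D) : omega L u y x = -omega L u x y := by
  simp only [omega_apply, neg_sub]

theorem hessian_apply (u : Phase D) (b : Config D) :
    hessian L u b = fderiv ℝ (momentum L) u (0, b) := rfl

theorem hessian_symm (hL : ContDiffOn ℝ ∞ L (phaseSpace Q)) {u : Phase D}
    (hu : u ∈ phaseSpace Q) (b c : Config D) : hessian L u b c = hessian L u c b := by
  rw [hessian_apply, hessian_apply, fderiv_momentum_apply hL hu, fderiv_momentum_apply hL hu,
    fderiv_fderiv_comm (smoothAt hL hu)]

/-- A vertical vector lies in the kernel of `Ω_L` exactly if its velocity part lies in `ker M`. -/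
theorem omega_vertical_eq_zero_iff (hL : ContDiffOn ℝ ∞ L (phaseSpace Q)) {u : Phase D}
    (hu : u ∈ phaseSpace Q) {x : Phase D} (hx : x.1 = 0) :
    omega L u x = 0 ↔ hessian L u x.2 = 0 := by
  have hx' : x = (0, x.2) := Prod.ext hx rfl
  constructor
  · intro h
    ext b
    have := congrArg (fun φ : Phase D →L[ℝ] ℝ => φ (b, 0)) h
    simp only [omega_apply_momentum hL hu, hx, map_zero, zero_apply, zero_sub, neg_eq_zero] at this
    rw [hessian_apply, ← hx', this]
    rfl
  · intro h
    ext y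
    all_goals
      rw [hessian_apply, ← hx'] at h
      simp [omega_apply_momentum hL hu, hx, h]

/-- The position part of a vector in the kernel of `Ω_L` lies in `ker M`. -/
theorem hessian_fst_eq_zero (hL : ContDiffOn ℝ ∞ L (phaseSpace Q)) {u : Phase D}
    (hu : u ∈ phaseSpace Q) {x : Phase D} (hx : omega L u x = 0) : hessian L u x.1 = 0 := by
  ext b
  have := congrArg (fun φ : Phase D →L[ℝ] ℝ => φ (0, b)) hx
  simp only [omega_apply_momentum hL hu, map_zero, zero_apply, sub_zero] at this
  rw [hessian_symm hL hu, hessian_apply, this]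
  rfl

theorem fderiv_energy_apply (hL : ContDiffOn ℝ ∞ L (phaseSpace Q)) {u : Phase D}
    (hu : u ∈ phaseSpace Q) (x : Phase D) :
    fderiv ℝ (energy L) u x = fderiv ℝ (momentum L) u x u.2 - fderiv ℝ L u (x.1, 0) := by
  have h : HasFDerivAt (energy L) _ u :=
    ((diffAt (smooth_momentum hL) hu).hasFDerivAt.clm_apply hasFDerivAt_snd).sub
      (diffAt hL hu).hasFDerivAt
  have h2 : fderiv ℝ L u x = fderiv ℝ L u (x.1, 0) + fderiv ℝ L u (0, x.2) := by
    rw [← map_add]; simp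
  rw [h.fderiv]
  simp [h2, momentum]
  ring

theorem fderiv_energy_gauge (hL : ContDiffOn ℝ ∞ L (phaseSpace Q)) {G : VF D}
    (hG : G ∈ gauge Q L) {u : Phase D} (hu : u ∈ phaseSpace Q) :
    fderiv ℝ (energy L) u (G u) = 0 := by
  obtain ⟨h1, h2⟩ := hG.2 u hu
  have hx' : G u = (0, (G u).2) := Prod.ext h1 rfl
  rw [hessian_apply, ← hx'] at h2
  rw [fderiv_energy_apply hL hu, h2, h1]
  exact (congrArg (fun r => (0 : ℝ) - r) (map_zero (fderiv ℝ L u))).trans (by simp)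

/-! ### The Lie derivative of the Lagrangian two-form -/

theorem fderiv_omega_apply (hL : ContDiffOn ℝ ∞ L (phaseSpace Q)) {u : Phase D}
    (hu : u ∈ phaseSpace Q) (a x y : Phase D) :
    fderiv ℝ (omega L) u a x y = fderiv ℝ (fderiv ℝ (theta L)) u a y x -
      fderiv ℝ (fderiv ℝ (theta L)) u a x y :=
  fderiv_flip_sub (diffAt (smooth_fderiv (smooth_theta hL)) hu) a x y

/-- The two-form `Ω_L = -dθ_L` is closed. -/
theorem omega_closed (hL : ContDiffOn ℝ ∞ L (phaseSpace Q)) {u : Phase D}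
    (hu : u ∈ phaseSpace Q) (a b c : Phase D) :
    fderiv ℝ (omega L) u a b c + fderiv ℝ (omega L) u b c a + fderiv ℝ (omega L) u c a b = 0 := by
  simp only [fderiv_omega_apply hL hu]
  rw [fderiv_fderiv_comm (smoothAt (smooth_theta hL) hu) b a,
    fderiv_fderiv_comm (smoothAt (smooth_theta hL) hu) c a,
    fderiv_fderiv_comm (smoothAt (smooth_theta hL) hu) c b]
  ring

theorem fderiv_omega_swap (hL : ContDiffOn ℝ ∞ L (phaseSpace Q)) {u : Phase D}
    (hu : u ∈ phaseSpace Q) (a b c : Phase D) :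
    fderiv ℝ (omega L) u a b c = -fderiv ℝ (omega L) u a c b := by
  simp only [fderiv_omega_apply hL hu]
  ring

/-- If the vector field `P` takes values in the kernel of `Ω_L`, the Lie derivative of `Ω_L` along
`P` vanishes: `𝔏_P Ω_L = d i_P Ω_L + i_P dΩ_L = 0`. -/
theorem lieDeriv_omega (hL : ContDiffOn ℝ ∞ L (phaseSpace Q)) {P : VF D}
    (hP : ContDiffOn ℝ ∞ P (phaseSpace Q)) (hk : ∀ u ∈ phaseSpace Q, omega L u (P u) = 0)
    {u : Phase D} (hu : u ∈ phaseSpace Q) (x y : Phase D) :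
    fderiv ℝ (omega L) u (P u) x y + omega L u (fderiv ℝ P u x) y +
      omega L u x (fderiv ℝ P u y) = 0 := by
  have key : ∀ x y, fderiv ℝ (omega L) u x (P u) y + omega L u (fderiv ℝ P u x) y = 0 := by
    intro x y
    have h := (diffAt (smooth_omega hL) hu).hasFDerivAt.clm_apply (diffAt hP hu).hasFDerivAt
    have h0 : (fun u => omega L u (P u)) =ᶠ[𝓝 u] fun _ => 0 :=
      (eventually_mem_phaseSpace hu).mono fun u' hu' => hk u' hu'
    have h1 := h.fderiv.symm.trans (h0.fderiv_eq.trans (fderiv_const_apply _))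
    have h2 := congrArg (fun φ : Phase D →L[ℝ] Phase D →L[ℝ] ℝ => φ x y) h1
    simpa [add_comm] using h2
  have h1 := key x y
  have h2 := key y x
  have h3 := omega_closed hL hu (P u) x y
  rw [omega_swap u (fderiv ℝ P u y) x]
  rw [fderiv_omega_swap hL hu x y] at h3
  linarith

/-- `𝔏_P (i_X Ω_L) = i_[P, X] Ω_L` if `P` takes values in the kernel of `Ω_L`. -/
theorem lieDerivForm_omega (hL : ContDiffOn ℝ ∞ L (phaseSpace Q)) {P X : VF D}
    (hP : ContDiffOn ℝ ∞ P (phaseSpace Q)) (hk : ∀ u ∈ phaseSpace Q, omega L u (P u) = 0)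
    {u : Phase D} (hu : u ∈ phaseSpace Q) (hX : DifferentiableAt ℝ X u) :
    lieDerivForm P (fun u => omega L u (X u)) u =
      omega L u (VectorField.lieBracket ℝ P X u) := by
  have h := (diffAt (smooth_omega hL) hu).hasFDerivAt.clm_apply hX.hasFDerivAt
  refine ContinuousLinearMap.ext fun y => ?_
  have h2 := lieDeriv_omega hL hP hk hu (X u) y
  rw [lieDerivForm, h.fderiv, VectorField.lieBracket]
  simp only [add_apply, ContinuousLinearMap.comp_apply,
    ContinuousLinearMap.flip_apply, map_sub, sub_apply]
  linarith

theorem lieDerivForm_congr {P : VF D} {α β : Phase D → Phase D →L[ℝ] ℝ} {u : Phase D}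
    (h : α =ᶠ[𝓝 u] β) : lieDerivForm P α u = lieDerivForm P β u := by
  rw [lieDerivForm, lieDerivForm, h.fderiv_eq, h.eq_of_nhds]

/-- `𝔏_P dE = d (P E)`. -/
theorem lieDerivForm_fderiv_energy (hL : ContDiffOn ℝ ∞ L (phaseSpace Q)) {P : VF D}
    {u : Phase D} (hu : u ∈ phaseSpace Q) (hP : DifferentiableAt ℝ P u) :
    lieDerivForm P (fderiv ℝ (energy L)) u =
      fderiv ℝ (fun u => fderiv ℝ (energy L) u (P u)) u := by
  have h := (diffAt (smooth_fderiv (smooth_energy hL)) hu).hasFDerivAt.clm_apply hP.hasFDerivAt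
  rw [h.fderiv, lieDerivForm]
  refine ContinuousLinearMap.ext fun y => ?_
  simp [fderiv_fderiv_comm (smoothAt (smooth_energy hL) hu) (P u) y, add_comm]

/-- The kernel of `Ω_L` is involutive. -/
theorem omega_lieBracket_eq_zero (hL : ContDiffOn ℝ ∞ L (phaseSpace Q)) {P K : VF D}
    (hP : ContDiffOn ℝ ∞ P (phaseSpace Q)) (hk : ∀ u ∈ phaseSpace Q, omega L u (P u) = 0)
    {u : Phase D} (hu : u ∈ phaseSpace Q) (hK : DifferentiableAt ℝ K u)
    (hK0 : ∀ᶠ u' in 𝓝 u, omega L u' (K u') = 0) :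
    omega L u (VectorField.lieBracket ℝ P K u) = 0 := by
  have h0 : (fun u => omega L u (K u)) =ᶠ[𝓝 u] fun _ => 0 := hK0
  rw [← lieDerivForm_omega hL hP hk hu hK, lieDerivForm_congr h0]
  simp [lieDerivForm]

theorem fderiv_energy_lieBracket (hL : ContDiffOn ℝ ∞ L (phaseSpace Q)) {P K : VF D}
    {u : Phase D} (hu : u ∈ phaseSpace Q) (hP : DifferentiableAt ℝ P u)
    (hK : DifferentiableAt ℝ K u) :
    fderiv ℝ (energy L) u (VectorField.lieBracket ℝ P K u) =
      fderiv ℝ (fun u => fderiv ℝ (energy L) u (K u)) u (P u) -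
        fderiv ℝ (fun u => fderiv ℝ (energy L) u (P u)) u (K u) := by
  rw [← lieDerivForm_fderiv_energy hL hu hP, ← lieDerivForm_fderiv_energy hL hu hK]
  simp [lieDerivForm, VectorField.lieBracket,
    fderiv_fderiv_comm (smoothAt (smooth_energy hL) hu) (P u) (K u)]

/-! ### The Lie algebra of classes -/

theorem smooth_lieBracket {P K : VF D} (hP : ContDiffOn ℝ ∞ P (phaseSpace Q))
    (hK : ContDiffOn ℝ ∞ K (phaseSpace Q)) :
    ContDiffOn ℝ ∞ (VectorField.lieBracket ℝ P K) (phaseSpace Q) :=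
  ((smooth_fderiv hK).clm_apply hP).sub ((smooth_fderiv hP).clm_apply hK)

theorem fderiv_apply_fst {K : VF D} {u : Phase D} (hK : DifferentiableAt ℝ K u) (x : Phase D) :
    (fderiv ℝ K u x).1 = fderiv ℝ (fun u => (K u).1) u x := by
  rw [hK.hasFDerivAt.fst.fderiv]; rfl

theorem gauge_omega (hL : ContDiffOn ℝ ∞ L (phaseSpace Q)) {G : VF D} (hG : G ∈ gauge Q L)
    {u : Phase D} (hu : u ∈ phaseSpace Q) : omega L u (G u) = 0 :=
  (omega_vertical_eq_zero_iff hL hu (hG.2 u hu).1).2 (hG.2 u hu).2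

theorem fderiv_gauge_fst {G : VF D} (hG : G ∈ gauge Q L) {u : Phase D} (hu : u ∈ phaseSpace Q)
    (x : Phase D) : (fderiv ℝ G u x).1 = 0 := by
  have h0 : (fun u => (G u).1) =ᶠ[𝓝 u] fun _ => 0 :=
    (eventually_mem_phaseSpace hu).mono fun u' hu' => (hG.2 u' hu').1
  rw [fderiv_apply_fst (diffAt hG.1 hu), h0.fderiv_eq]
  simp

theorem gauge_le_kerBar (hL : ContDiffOn ℝ ∞ L (phaseSpace Q)) : gauge Q L ≤ kerBar Q L := by
  refine fun G hG => ⟨hG.1, fun u hu => gauge_omega hL hG hu, fun G' hG' u hu => ?_⟩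
  simp [VectorField.lieBracket, fderiv_gauge_fst hG hu, fderiv_gauge_fst hG' hu]

theorem lieBracket_mem_gauge (hL : ContDiffOn ℝ ∞ L (phaseSpace Q)) {P G : VF D}
    (hP : P ∈ kerBar Q L) (hG : G ∈ gauge Q L) : VectorField.lieBracket ℝ P G ∈ gauge Q L := by
  have h1 : ∀ u ∈ phaseSpace Q, (VectorField.lieBracket ℝ P G u).1 = 0 := fun u hu => by
    rw [VectorField.lieBracket_swap, Prod.fst_neg, hP.2.2 G hG u hu, neg_zero]
  refine ⟨smooth_lieBracket hP.1 hG.1, fun u hu => ⟨h1 u hu, ?_⟩⟩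
  refine (omega_vertical_eq_zero_iff hL hu (h1 u hu)).1 ?_
  exact omega_lieBracket_eq_zero hL hP.1 hP.2.1 hu (diffAt hG.1 hu)
    ((eventually_mem_phaseSpace hu).mono fun u' hu' => gauge_omega hL hG hu')

theorem lieBracket_mem_kerBar (hL : ContDiffOn ℝ ∞ L (phaseSpace Q)) {P₁ P₂ : VF D}
    (h₁ : P₁ ∈ kerBar Q L) (h₂ : P₂ ∈ kerBar Q L) :
    VectorField.lieBracket ℝ P₁ P₂ ∈ kerBar Q L := by
  refine ⟨smooth_lieBracket h₁.1 h₂.1, fun u hu => omega_lieBracket_eq_zero hL h₁.1 h₁.2.1 hu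
    (diffAt h₂.1 hu) ((eventually_mem_phaseSpace hu).mono h₂.2.1), fun G hG u hu => ?_⟩
  rw [VectorField.leibniz_identity_lieBracket (n := ∞) (by simpa using two_le_smooth)
    (smoothAt hG.1 hu) (smoothAt h₁.1 hu) (smoothAt h₂.1 hu)]
  have e1 : VectorField.lieBracket ℝ G P₁ ∈ gauge Q L := by
    rw [show VectorField.lieBracket ℝ G P₁ = -VectorField.lieBracket ℝ P₁ G from
      funext fun _ => VectorField.lieBracket_swap]
    exact neg_mem (lieBracket_mem_gauge hL h₁ hG)
  have e2 : VectorField.lieBracket ℝ G P₂ ∈ gauge Q L := by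
    rw [show VectorField.lieBracket ℝ G P₂ = -VectorField.lieBracket ℝ P₂ G from
      funext fun _ => VectorField.lieBracket_swap]
    exact neg_mem (lieBracket_mem_gauge hL h₂ hG)
  rw [Prod.fst_add, h₂.2.2 _ e1 u hu, ((lieBracket_mem_gauge hL h₁ e2).2 u hu).1, add_zero]

theorem cls_mem_symL_iff (hL : ContDiffOn ℝ ∞ L (phaseSpace Q)) {P : VF D}
    (hP : P ∈ kerBar Q L) :
    cls P hP ∈ symL Q L ↔ ∀ u ∈ phaseSpace Q, fderiv ℝ (energy L) u (P u) = 0 := by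
  constructor
  · rintro ⟨P', hP', h⟩ u hu
    have h' := (Submodule.Quotient.eq _).1 h
    have h2 : (P' : VF D) - P ∈ gauge Q L := h'
    have h3 := fderiv_energy_gauge hL h2 hu
    have h4 : fderiv ℝ (energy L) u ((P' : VF D) u) = 0 := hP' u hu
    rw [Pi.sub_apply, map_sub, h4] at h3
    linarith
  · exact fun h => ⟨⟨P, hP⟩, h, rfl⟩

theorem mem_representatives_symL_iff (hL : ContDiffOn ℝ ∞ L (phaseSpace Q)) {P : VF D} :
    P ∈ representatives (symL Q L : Set (KerBarQuot Q L)) ↔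
      P ∈ kerBar Q L ∧ ∀ u ∈ phaseSpace Q, fderiv ℝ (energy L) u (P u) = 0 := by
  constructor
  · rintro ⟨hP, h⟩
    exact ⟨hP, (cls_mem_symL_iff hL hP).1 h⟩
  · rintro ⟨hP, h⟩
    exact ⟨hP, (cls_mem_symL_iff hL hP).2 h⟩

theorem lieBracket_mem_representatives_symL (hL : ContDiffOn ℝ ∞ L (phaseSpace Q)) {P₁ P₂ : VF D}
    (h₁ : P₁ ∈ representatives (symL Q L : Set (KerBarQuot Q L)))
    (h₂ : P₂ ∈ representatives (symL Q L : Set (KerBarQuot Q L))) :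
    VectorField.lieBracket ℝ P₁ P₂ ∈ representatives (symL Q L : Set (KerBarQuot Q L)) := by
  rw [mem_representatives_symL_iff hL] at h₁ h₂ ⊢
  refine ⟨lieBracket_mem_kerBar hL h₁.1 h₂.1, fun u hu => ?_⟩
  have e1 : (fun u => fderiv ℝ (energy L) u (P₁ u)) =ᶠ[𝓝 u] fun _ => 0 :=
    (eventually_mem_phaseSpace hu).mono h₁.2
  have e2 : (fun u => fderiv ℝ (energy L) u (P₂ u)) =ᶠ[𝓝 u] fun _ => 0 :=
    (eventually_mem_phaseSpace hu).mono h₂.2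
  rw [fderiv_energy_lieBracket hL hu (diffAt h₁.1.1 hu) (diffAt h₂.1.1 hu), e1.fderiv_eq,
    e2.fderiv_eq]
  simp

/-! ### Generalized inverses of families of constant rank -/

section GeneralizedInverse

variable {X E F : Type*} [NormedAddCommGroup X] [NormedSpace ℝ X]
  [NormedAddCommGroup E] [NormedSpace ℝ E] [FiniteDimensional ℝ E]
  [NormedAddCommGroup F] [NormedSpace ℝ F]

theorem exists_generalizedInverse [FiniteDimensional ℝ F] (B : E →L[ℝ] F) :
    ∃ C : F →L[ℝ] E, ∀ x, B (C (B x)) = B x := by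
  obtain ⟨g, hg⟩ := (B : E →ₗ[ℝ] F).rangeRestrict.exists_rightInverse_of_surjective
    (LinearMap.range_rangeRestrict _)
  obtain ⟨h, hh⟩ := g.exists_extend
  refine ⟨LinearMap.toContinuousLinearMap h, fun x => ?_⟩
  have h1 : h (B x) = g ((B : E →ₗ[ℝ] F).rangeRestrict x) := by
    rw [← hh]; rfl
  have h2 := congrArg Subtype.val
    (LinearMap.congr_fun hg ((B : E →ₗ[ℝ] F).rangeRestrict x))
  simpa [h1] using h2

/-- If `C` is a generalized inverse of `B₀` and `B` has the rank of `B₀`, then `C R⁻¹` with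
`R = 1 + (B - B₀) C` is a generalized inverse of `B`: the map `R` carries the range of `B₀` onto
the range of `B`, because `R B₀ = B C B₀`. -/
theorem generalizedInverse_of_rank_eq {B B₀ : E →L[ℝ] F} {C : F →L[ℝ] E}
    (hC : ∀ x, B₀ (C (B₀ x)) = B₀ x)
    (hr : Module.finrank ℝ (LinearMap.range (B : E →ₗ[ℝ] F)) =
      Module.finrank ℝ (LinearMap.range (B₀ : E →ₗ[ℝ] F)))
    (hR : IsUnit (1 + (B - B₀) ∘L C)) (x : E) :
    B (C (Ring.inverse (1 + (B - B₀) ∘L C) (B x))) = B x := by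
  set R : F →L[ℝ] F := 1 + (B - B₀) ∘L C with hRdef
  have hinv : ∀ y, Ring.inverse R (R y) = y := fun y => by
    have := congrArg (fun T : F →L[ℝ] F => T y) (Ring.inverse_mul_cancel R hR)
    simpa using this
  have hRB : ∀ y, R (B₀ y) = B (C (B₀ y)) := fun y => by
    simp [hRdef, hC]
  have hinj : Function.Injective (R : F →ₗ[ℝ] F) := Function.LeftInverse.injective hinv
  have hle : (LinearMap.range (B₀ : E →ₗ[ℝ] F)).map (R : F →ₗ[ℝ] F) ≤
      LinearMap.range (B : E →ₗ[ℝ] F) := by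
    rintro _ ⟨_, ⟨y, rfl⟩, rfl⟩
    exact ⟨C (B₀ y), (hRB y).symm⟩
  have heq := Submodule.eq_of_le_of_finrank_eq hle
    ((LinearEquiv.finrank_eq (Submodule.equivMapOfInjective _ hinj _)).symm.trans hr.symm)
  have hx : B x ∈ LinearMap.range (B : E →ₗ[ℝ] F) := ⟨x, rfl⟩
  rw [← heq] at hx
  obtain ⟨_, ⟨y, rfl⟩, hy⟩ := hx
  have hy' : R (B₀ y) = B x := hy
  rw [← hy', hinv, hRB]

/-- A smooth family of linear maps of constant rank has, near each point, a smooth family of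
generalized inverses. -/
theorem exists_smoothAt_generalizedInverse [FiniteDimensional ℝ F] {U : Set X} (hU : IsOpen U)
    {B : X → E →L[ℝ] F}
    (hB : ContDiffOn ℝ ∞ B U) {r : ℕ}
    (hr : ∀ u ∈ U, Module.finrank ℝ (LinearMap.range (B u : E →ₗ[ℝ] F)) = r) {u₀ : X}
    (hu₀ : u₀ ∈ U) :
    ∃ J : X → F →L[ℝ] E, ContDiffAt ℝ ∞ J u₀ ∧ ∀ᶠ u in 𝓝 u₀, ∀ x, B u (J u (B u x)) = B u x := by
  obtain ⟨C, hC⟩ := exists_generalizedInverse (B u₀)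
  have hR : ContDiffAt ℝ ∞ (fun u => 1 + (B u - B u₀) ∘L C) u₀ :=
    contDiffAt_const.add (((hB.contDiffAt (hU.mem_nhds hu₀)).sub contDiffAt_const).clm_comp
      contDiffAt_const)
  have h1 : (1 : F →L[ℝ] F) + (B u₀ - B u₀) ∘L C = ((1 : (F →L[ℝ] F)ˣ) : F →L[ℝ] F) := by simp
  have hev : ∀ᶠ u in 𝓝 u₀, IsUnit (1 + (B u - B u₀) ∘L C) := by
    have := Units.nhds (1 : (F →L[ℝ] F)ˣ)
    rw [← h1] at this
    exact hR.continuousAt.eventually this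
  refine ⟨fun u => C ∘L Ring.inverse (1 + (B u - B u₀) ∘L C), contDiffAt_const.clm_comp ?_, ?_⟩
  · have h2 := contDiffAt_ringInverse ℝ (n := ∞) (1 : (F →L[ℝ] F)ˣ)
    rw [← h1] at h2
    exact h2.comp u₀ hR
  · filter_upwards [hev, hU.mem_nhds hu₀] with u hu huU x
    exact generalizedInverse_of_rank_eq hC ((hr u huU).trans (hr u₀ hu₀).symm) hu x

end GeneralizedInverse

section Symmetric

variable {X E : Type*} [NormedAddCommGroup X] [NormedSpace ℝ X]
  [NormedAddCommGroup E] [InnerProductSpace ℝ E]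

theorem eq_of_apply_apply_eq {A : E →L[ℝ] E} (hA : ∀ x y, inner ℝ (A x) y = inner ℝ x (A y))
    {x y : E} (h : A (A x) = A (A y)) : A x = A y := by
  have h0 : A (A (x - y)) = 0 := by simp [h]
  have h1 : inner ℝ (A (x - y)) (A (x - y)) = 0 := by rw [hA, h0, inner_zero_right]
  have h2 : A (x - y) = 0 := inner_self_eq_zero.1 h1
  rwa [map_sub, sub_eq_zero] at h2

theorem exists_apply_apply_eq [FiniteDimensional ℝ E] {A : E →L[ℝ] E}
    (hA : ∀ x y, inner ℝ (A x) y = inner ℝ x (A y)) (y : E) : ∃ x, A (A x) = A y := by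
  set a : E →ₗ[ℝ] E := (A : E →ₗ[ℝ] E)
  have hk : LinearMap.ker (a ∘ₗ a) = LinearMap.ker a := by
    refine le_antisymm (fun x hx => ?_) (LinearMap.ker_le_ker_comp a a)
    have h : A (A x) = A (A 0) := by
      rw [map_zero, map_zero]; exact hx
    simpa [a] using eq_of_apply_apply_eq hA h
  have h1 := LinearMap.finrank_range_add_finrank_ker (a ∘ₗ a)
  have h2 := LinearMap.finrank_range_add_finrank_ker a
  rw [hk] at h1
  have heq := Submodule.eq_of_le_of_finrank_eq (LinearMap.range_comp_le_range a a) (by omega)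
  have hy : a y ∈ LinearMap.range a := ⟨y, rfl⟩
  rw [← heq] at hy
  exact hy

/-- The Moore-Penrose inverse of a symmetric map `A`: it is the only generalized inverse of the
form `A K A`. -/
theorem generalizedInverse_unique [FiniteDimensional ℝ E] {A K K' : E →L[ℝ] E}
    (hA : ∀ x y, inner ℝ (A x) y = inner ℝ x (A y))
    (h : ∀ x, A (A (K (A (A x)))) = A x) (h' : ∀ x, A (A (K' (A (A x)))) = A x) (x : E) :
    A (K (A x)) = A (K' (A x)) := by
  obtain ⟨y, hy⟩ := exists_apply_apply_eq hA x
  rw [← hy]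
  exact eq_of_apply_apply_eq hA ((h y).trans (h' y).symm)

/-- A smooth family of symmetric maps of constant rank has a smooth family of generalized inverses
on its whole domain, since its Moore-Penrose inverse can be computed from any local smooth
generalized inverse of its third power. -/
theorem exists_smooth_generalizedInverse [FiniteDimensional ℝ E] {U : Set X} (hU : IsOpen U)
    {A : X → E →L[ℝ] E}
    (hA : ContDiffOn ℝ ∞ A U) (hs : ∀ u ∈ U, ∀ x y, inner ℝ (A u x) y = inner ℝ x (A u y)) {r : ℕ}
    (hr : ∀ u ∈ U, Module.finrank ℝ (LinearMap.range (A u : E →ₗ[ℝ] E)) = r) :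
    ∃ J : X → E →L[ℝ] E, ContDiffOn ℝ ∞ J U ∧ ∀ u ∈ U, ∀ x, A u (J u (A u x)) = A u x := by
  set T : X → E →L[ℝ] E := fun u => A u ∘L A u ∘L A u with hT
  have hTs : ContDiffOn ℝ ∞ T U := hA.clm_comp (hA.clm_comp hA)
  have hTr : ∀ u ∈ U, Module.finrank ℝ (LinearMap.range (T u : E →ₗ[ℝ] E)) = r := by
    intro u hu
    rw [← hr u hu]
    suffices h : LinearMap.range (T u : E →ₗ[ℝ] E) = LinearMap.range (A u : E →ₗ[ℝ] E) by rw [h]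
    refine le_antisymm ?_ ?_
    · rintro _ ⟨x, rfl⟩
      exact ⟨A u (A u x), rfl⟩
    · rintro _ ⟨x, rfl⟩
      obtain ⟨y, hy⟩ := exists_apply_apply_eq (hs u hu) x
      obtain ⟨z, hz⟩ := exists_apply_apply_eq (hs u hu) y
      exact ⟨z, by simp [hT, hz, hy]⟩
  have hloc : ∀ u ∈ U, ∃ K : X → E →L[ℝ] E, ContDiffAt ℝ ∞ K u ∧
      ∀ᶠ u' in 𝓝 u, ∀ x, A u' (A u' (K u' (A u' (A u' x)))) = A u' x := by
    intro u hu
    obtain ⟨K, hK, hK'⟩ := exists_smoothAt_generalizedInverse hU hTs hTr hu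
    refine ⟨K, hK, ?_⟩
    filter_upwards [hK', hU.mem_nhds hu] with u' h hu' x
    obtain ⟨y, hy⟩ := exists_apply_apply_eq (hs u' hu') x
    rw [← hy]
    exact eq_of_apply_apply_eq (hs u' hu') (h y)
  have hpt : ∀ u, ∃ K : E →L[ℝ] E, u ∈ U → ∀ x, A u (A u (K (A u (A u x)))) = A u x := by
    intro u
    by_cases hu : u ∈ U
    · obtain ⟨K, _, hK⟩ := hloc u hu
      exact ⟨K u, fun _ => hK.self_of_nhds⟩
    · exact ⟨0, fun h => absurd h hu⟩
  choose K₀ hK₀ using hpt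
  refine ⟨fun u => A u ∘L K₀ u ∘L A u, fun u hu => ContDiffAt.contDiffWithinAt ?_,
    fun u hu x => hK₀ u hu x⟩
  obtain ⟨K, hK, hK'⟩ := hloc u hu
  have hAu := hA.contDiffAt (hU.mem_nhds hu)
  refine (hAu.clm_comp (hK.clm_comp hAu)).congr_of_eventuallyEq ?_
  filter_upwards [hK', hU.mem_nhds hu] with u' h hu'
  ext1 x
  exact generalizedInverse_unique (hs u' hu') (hK₀ u' hu') h x

end Symmetric

/-- The Hessian `M` of constant rank has a smooth generalized inverse on the phase space. -/
theorem exists_hessian_generalizedInverse (hL : ContDiffOn ℝ ∞ L (phaseSpace Q))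
    (hM : HessianConstantRank Q L) :
    ∃ J : Phase D → (Config D →L[ℝ] ℝ) →L[ℝ] Config D, ContDiffOn ℝ ∞ J (phaseSpace Q) ∧
      ∀ u ∈ phaseSpace Q, ∀ b, hessian L u (J u (hessian L u b)) = hessian L u b := by
  obtain ⟨r, hr⟩ := hM
  set e : (Config D →L[ℝ] ℝ) ≃L[ℝ] Config D :=
    (InnerProductSpace.toDual ℝ (Config D)).symm.toContinuousLinearEquiv with he
  have hin : ∀ (φ : Config D →L[ℝ] ℝ) (y : Config D), inner ℝ (e φ) y = φ y := fun φ y =>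
    InnerProductSpace.toDual_symm_apply
  set A : Phase D → Config D →L[ℝ] Config D := fun u =>
    (e : (Config D →L[ℝ] ℝ) →L[ℝ] Config D) ∘L hessian L u with hAdef
  obtain ⟨J, hJ, hJ'⟩ := exists_smooth_generalizedInverse (isOpen_phaseSpace Q) (A := A) (r := r)
    (contDiffOn_const.clm_comp (smooth_hessian hL))
    (fun u hu x y => by
      rw [real_inner_comm (A u y) x]
      exact (hin _ _).trans ((hessian_symm hL hu x y).trans (hin _ _).symm))
    (fun u hu => by
      rw [← hr u hu]
      have : LinearMap.range (A u : Config D →ₗ[ℝ] Config D) =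
          (LinearMap.range (hessian L u : Config D →ₗ[ℝ] Config D →L[ℝ] ℝ)).map
            (e.toLinearEquiv : (Config D →L[ℝ] ℝ) →ₗ[ℝ] Config D) :=
        LinearMap.range_comp _ _
      rw [this, LinearEquiv.finrank_map_eq])
  refine ⟨fun u => J u ∘L (e : (Config D →L[ℝ] ℝ) →L[ℝ] Config D), hJ.clm_comp contDiffOn_const,
    fun u hu b => e.injective (hJ' u hu b)⟩

/-- A smooth projection onto the gauge directions: the values of `N` at a point `u` project the
phase space onto `{(0, z) | M z = 0}`. -/
structure IsGaugeProjection (Q : TopologicalSpace.Opens (Config D)) (L : Phase D → ℝ)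
    (N : Phase D → Phase D →L[ℝ] Phase D) : Prop where
  smooth : ContDiffOn ℝ ∞ N (phaseSpace Q)
  fst_eq_zero : ∀ u ∈ phaseSpace Q, ∀ x, (N u x).1 = 0
  hessian_eq_zero : ∀ u ∈ phaseSpace Q, ∀ x, hessian L u (N u x).2 = 0
  apply_eq_self : ∀ u ∈ phaseSpace Q, ∀ z, hessian L u z = 0 → N u (0, z) = (0, z)

theorem exists_gaugeProjection (hL : ContDiffOn ℝ ∞ L (phaseSpace Q))
    (hM : HessianConstantRank Q L) : ∃ N, IsGaugeProjection Q L N := by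
  obtain ⟨J, hJ, hJ'⟩ := exists_hessian_generalizedInverse hL hM
  have hh := smooth_hessian hL
  refine ⟨fun u => ContinuousLinearMap.inr ℝ (Config D) (Config D) ∘L
    (ContinuousLinearMap.id ℝ (Config D) - J u ∘L hessian L u) ∘L
      ContinuousLinearMap.snd ℝ (Config D) (Config D), ?_, ?_, ?_, ?_⟩
  · exact contDiffOn_const.clm_comp
      ((contDiffOn_const.sub (hJ.clm_comp hh)).clm_comp contDiffOn_const)
  · intro u _ x; simp
  · intro u hu x; simp [hJ' u hu]
  · intro u _ z hz; simp [hz]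

theorem IsGaugeProjection.apply_mem_gauge {N : Phase D → Phase D →L[ℝ] Phase D}
    (hN : IsGaugeProjection Q L N) (x : Phase D) : (fun u => N u x) ∈ gauge Q L :=
  ⟨hN.smooth.clm_apply contDiffOn_const, fun u hu =>
    ⟨hN.fst_eq_zero u hu x, hN.hessian_eq_zero u hu x⟩⟩

theorem exists_gauge_apply_eq (hL : ContDiffOn ℝ ∞ L (phaseSpace Q))
    (hM : HessianConstantRank Q L) {u : Phase D} (hu : u ∈ phaseSpace Q) {z : Config D}
    (hz : hessian L u z = 0) : ∃ G ∈ gauge Q L, G u = (0, z) := by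
  obtain ⟨N, hN⟩ := exists_gaugeProjection hL hM
  exact ⟨_, hN.apply_mem_gauge (0, z), hN.apply_eq_self u hu z hz⟩

/-- Near each point there is a smooth projection onto the kernel of `Ω_L`. -/
theorem exists_omega_projection (hL : ContDiffOn ℝ ∞ L (phaseSpace Q))
    (hΩ : OmegaConstantRank Q L) {u₀ : Phase D} (hu₀ : u₀ ∈ phaseSpace Q) :
    ∃ N : Phase D → Phase D →L[ℝ] Phase D, ContDiffAt ℝ ∞ N u₀ ∧
      ∀ᶠ u in 𝓝 u₀, (∀ x, omega L u (N u x) = 0) ∧ ∀ x, omega L u x = 0 → N u x = x := by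
  obtain ⟨r, hr⟩ := hΩ
  obtain ⟨J, hJ, hJ'⟩ := exists_smoothAt_generalizedInverse (isOpen_phaseSpace Q)
    (smooth_omega hL) hr hu₀
  refine ⟨fun u => ContinuousLinearMap.id ℝ (Phase D) - J u ∘L omega L u,
    contDiffAt_const.sub (hJ.clm_comp (smoothAt (smooth_omega hL) hu₀)), ?_⟩
  filter_upwards [hJ'] with u hu
  exact ⟨fun x => by simp [hu], fun x hx => by simp [hx]⟩

/-! ### Constraint sets and invariance along integral curves -/

section Gronwall

variable {V : Type*} [NormedAddCommGroup V] [NormedSpace ℝ V]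

/-- Uniqueness of the zero solution of a linear differential inequality. -/
theorem eq_zero_of_norm_deriv_le {N N' : ℝ → V} {w : ℝ → ℝ} {δ : ℝ}
    (hN : ∀ s ∈ Icc 0 δ, HasDerivAt N (N' s) s) (hw : ContinuousOn w (Icc 0 δ))
    (hle : ∀ s ∈ Icc 0 δ, ‖N' s‖ ≤ w s * ‖N s‖) (h0 : N 0 = 0) : ∀ s ∈ Icc 0 δ, N s = 0 := by
  obtain ⟨K, hK⟩ := isCompact_Icc.exists_bound_of_continuousOn hw
  refine eq_zero_of_abs_deriv_le_mul_abs_self_of_eq_zero_right (K := K)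
    (fun s hs => (hN s hs).continuousAt.continuousWithinAt)
    (fun s hs => (hN s (Ico_subset_Icc_self hs)).hasDerivWithinAt) h0 fun s hs => ?_
  have hs' := Ico_subset_Icc_self hs
  exact (hle s hs').trans (mul_le_mul_of_nonneg_right ((le_abs_self _).trans (hK s hs'))
    (norm_nonneg _))

theorem eq_zero_of_norm_deriv_le_real {N N' : ℝ → V} {w : ℝ → ℝ}
    (hN : ∀ s, HasDerivAt N (N' s) s) (hw : Continuous w)
    (hle : ∀ s, ‖N' s‖ ≤ w s * ‖N s‖) (h0 : N 0 = 0) (s : ℝ) : N s = 0 := by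
  rcases le_total 0 s with hs | hs
  · exact eq_zero_of_norm_deriv_le (fun s _ => hN s) hw.continuousOn (fun s _ => hle s) h0 s
      ⟨hs, le_rfl⟩
  · have h := eq_zero_of_norm_deriv_le (N := fun s => N (-s)) (N' := fun s => -N' (-s))
      (w := fun s => w (-s)) (δ := -s) (fun s _ => by
        have h : HasDerivAt (fun s => N (-s)) _ s := (hN (-s)).scomp s (hasDerivAt_neg s)
        simpa using h)
      (hw.comp continuous_neg).continuousOn (fun s _ => by simpa using hle (-s)) (by simpa using h0)
      (-s) ⟨by linarith, le_rfl⟩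
    simpa using h

end Gronwall

/-- If `N` projects onto the kernel of `Ω_L` and `P` is a vector field in this kernel with
`P E = 0`, then the restriction `dE ∘ N` of `dE` to the kernel satisfies a linear differential
equation along `P`. -/
theorem fderiv_energy_comp_projection (hL : ContDiffOn ℝ ∞ L (phaseSpace Q)) {P : VF D}
    (hP : ContDiffOn ℝ ∞ P (phaseSpace Q)) (hk : ∀ u ∈ phaseSpace Q, omega L u (P u) = 0)
    (hE : ∀ u ∈ phaseSpace Q, fderiv ℝ (energy L) u (P u) = 0)
    {N : Phase D → Phase D →L[ℝ] Phase D} {u : Phase D} (hu : u ∈ phaseSpace Q)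
    (hN : DifferentiableAt ℝ N u)
    (hN' : ∀ᶠ u in 𝓝 u, (∀ x, omega L u (N u x) = 0) ∧ ∀ x, omega L u x = 0 → N u x = x) :
    fderiv ℝ (fun u => fderiv ℝ (energy L) u ∘L N u) u (P u) =
      (fderiv ℝ (energy L) u ∘L N u) ∘L (fderiv ℝ N u (P u) - fderiv ℝ P u ∘L N u) := by
  refine ContinuousLinearMap.ext fun y => ?_
  have hEd := diffAt (smooth_fderiv (smooth_energy hL)) hu
  have hK : HasFDerivAt (fun u => N u y) _ u := hN.hasFDerivAt.clm_apply (hasFDerivAt_const y u)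
  have h1 := ((hEd.clm_comp hN).hasFDerivAt.clm_apply (hasFDerivAt_const y u)).fderiv
  have h2 := fderiv_energy_lieBracket hL hu (diffAt hP hu) hK.differentiableAt
  have h3 : (fun u => fderiv ℝ (energy L) u (P u)) =ᶠ[𝓝 u] fun _ => 0 :=
    (eventually_mem_phaseSpace hu).mono hE
  have h4 : VectorField.lieBracket ℝ P (fun u => N u y) u =
      (fderiv ℝ N u (P u) - fderiv ℝ P u ∘L N u) y := by
    rw [VectorField.lieBracket, hK.fderiv]
    simp
  have h5 := omega_lieBracket_eq_zero hL hP hk hu hK.differentiableAt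
    (hN'.mono fun u' h => h.1 y)
  have h6 := hN'.self_of_nhds.2 _ h5
  have h7 := congrArg (fun φ : Phase D →L[ℝ] ℝ => φ (P u)) h1
  simp only [ContinuousLinearMap.comp_apply, add_apply,
    zero_apply, map_zero, zero_add, ContinuousLinearMap.flip_apply] at h7
  rw [ContinuousLinearMap.comp_apply, ContinuousLinearMap.comp_apply, ← h4, h6, h2, ← h7,
    h3.fderiv_eq]
  simp

/-- An integral curve of a vector field `P` in the kernel of `Ω_L` with `P E = 0` that starts on the
constraint set stays on it. -/
theorem exists_curve_in_constraintSet (hL : ContDiffOn ℝ ∞ L (phaseSpace Q))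
    (hΩ : OmegaConstantRank Q L) {P : VF D}
    (hP : ContDiffOn ℝ ∞ P (phaseSpace Q)) (hk : ∀ u ∈ phaseSpace Q, omega L u (P u) = 0)
    (hE : ∀ u ∈ phaseSpace Q, fderiv ℝ (energy L) u (P u) = 0) {u₀ : Phase D}
    (hu₀ : u₀ ∈ constraintSet Q L) :
    ∃ α : ℝ → Phase D, α 0 = u₀ ∧ HasDerivAt α (P u₀) 0 ∧
      ∃ δ > 0, ∀ s ∈ Icc (0 : ℝ) δ, α s ∈ constraintSet Q L := by
  obtain ⟨N, hNs, hN⟩ := exists_omega_projection hL hΩ hu₀.1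
  have hN2 : ∀ᶠ u in 𝓝 u₀, ContDiffAt ℝ 2 N u :=
    (hNs.of_le two_le_smooth).eventually (by decide)
  obtain ⟨α, hα0, ε, hε, hα⟩ := ((smoothAt hP hu₀.1).of_le
    (by simp)).exists_forall_mem_closedBall_exists_eq_forall_mem_Ioo_hasDerivAt₀ (0 : ℝ)
  rw [zero_sub, zero_add] at hα
  have hαc : ContinuousAt α 0 := (hα 0 ⟨by linarith, hε⟩).continuousAt
  have hgood : ∀ᶠ s in 𝓝 (0 : ℝ), (α s ∈ phaseSpace Q ∧ ContDiffAt ℝ 2 N (α s) ∧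
      (∀ᶠ u in 𝓝 (α s), (∀ x, omega L u (N u x) = 0) ∧ ∀ x, omega L u x = 0 → N u x = x)) ∧
      HasDerivAt α (P (α s)) s := by
    have h := (eventually_mem_phaseSpace hu₀.1).and (hN2.and hN.eventually_nhds)
    rw [← hα0] at h
    refine (hαc.eventually h).and ?_
    exact Filter.eventually_of_mem (Ioo_mem_nhds (by linarith) hε) hα
  obtain ⟨δ', hδ', hball⟩ := Metric.eventually_nhds_iff.1 hgood
  have hδ : ∀ s ∈ Icc (0 : ℝ) (δ' / 2), _ := fun s hs => hball (y := s) (by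
    rw [Real.dist_eq, sub_zero, abs_of_nonneg hs.1]; linarith [hs.2])
  set g : Phase D → Phase D →L[ℝ] ℝ := fun u => fderiv ℝ (energy L) u ∘L N u with hg
  have hEs := smooth_fderiv (smooth_energy hL)
  have hg0 : ∀ s ∈ Icc (0 : ℝ) (δ' / 2), g (α s) = 0 := by
    refine eq_zero_of_norm_deriv_le (N' := fun s => fderiv ℝ g (α s) (P (α s)))
      (w := fun s => ‖fderiv ℝ N (α s) (P (α s)) - fderiv ℝ P (α s) ∘L N (α s)‖)
      (fun s hs => ?_) (fun s hs => ?_) (fun s hs => ?_) ?_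
    · obtain ⟨⟨h1, h2, h3⟩, h4⟩ := hδ s hs
      exact ((diffAt hEs h1).clm_comp
        (h2.differentiableAt (by decide))).hasFDerivAt.comp_hasDerivAt s h4
    · obtain ⟨⟨h1, h2, h3⟩, h4⟩ := hδ s hs
      have e1 : ContinuousAt (fun u => fderiv ℝ N u (P u) - fderiv ℝ P u ∘L N u) (α s) :=
        ((h2.fderiv_right (m := 1) (by norm_num)).continuousAt.clm_apply
          (diffAt hP h1).continuousAt).sub
          ((diffAt (smooth_fderiv hP) h1).continuousAt.clm_comp h2.continuousAt)
      exact (ContinuousAt.comp (f := α) e1 h4.continuousAt).norm.continuousWithinAt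
    · obtain ⟨⟨h1, h2, h3⟩, h4⟩ := hδ s hs
      have h5 := fderiv_energy_comp_projection hL hP hk hE h1
        (h2.differentiableAt (by decide)) h3
      simp only [hg]
      rw [h5, mul_comm]
      exact ContinuousLinearMap.opNorm_comp_le _ _
    · rw [hα0]
      exact ContinuousLinearMap.ext fun y => hu₀.2 _ (hN.self_of_nhds.1 y)
  refine ⟨α, hα0, hα0 ▸ hα 0 ⟨by linarith, hε⟩, δ' / 2, by linarith, fun s hs => ?_⟩
  obtain ⟨⟨h1, h2, h3⟩, h4⟩ := hδ s hs
  refine ⟨h1, fun K hK => ?_⟩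
  have := congrArg (fun φ : Phase D →L[ℝ] ℝ => φ K) (hg0 s hs)
  simpa [hg, h3.self_of_nhds.2 K hK] using this

theorem beta_eq_zero {X : VF D} (hX : X ∈ sol Q L) {u : Phase D} (hu : u ∈ constraintSet Q L) :
    beta L X u = 0 := by
  rw [beta, hX.2 u hu, sub_self]

theorem smooth_beta (hL : ContDiffOn ℝ ∞ L (phaseSpace Q)) {X : VF D} (hX : X ∈ sol Q L) :
    ContDiffOn ℝ ∞ (beta L X) (phaseSpace Q) :=
  (smooth_fderiv (smooth_energy hL)).sub ((smooth_omega hL).clm_apply hX.1)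

/-- The constraint one-form vanishes on the constraint set, and `P` is tangent to this set in the
sense that it admits integral curves inside it. -/
theorem lieDerivForm_beta (hL : ContDiffOn ℝ ∞ L (phaseSpace Q)) (hΩ : OmegaConstantRank Q L)
    {P X : VF D} (hP : ContDiffOn ℝ ∞ P (phaseSpace Q))
    (hk : ∀ u ∈ phaseSpace Q, omega L u (P u) = 0)
    (hE : ∀ u ∈ phaseSpace Q, fderiv ℝ (energy L) u (P u) = 0) (hX : X ∈ sol Q L) {u : Phase D}
    (hu : u ∈ constraintSet Q L) : lieDerivForm P (beta L X) u = 0 := by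
  obtain ⟨α, hα0, hα, δ, hδ, hαδ⟩ := exists_curve_in_constraintSet hL hΩ hP hk hE hu
  have h1 : HasDerivAt (fun s => beta L X (α s)) (fderiv ℝ (beta L X) u (P u)) 0 := by
    have hb := (diffAt (smooth_beta hL hX) hu.1).hasFDerivAt
    rw [← hα0] at hb
    have := hb.comp_hasDerivAt 0 hα
    rwa [hα0] at this
  have h2 : HasDerivWithinAt (fun s => beta L X (α s)) 0 (Icc 0 δ) 0 :=
    (hasDerivWithinAt_const (0 : ℝ) (Icc 0 δ) (0 : Phase D →L[ℝ] ℝ)).congr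
      (fun s hs => beta_eq_zero hX (hαδ s hs)) (by rw [hα0]; exact beta_eq_zero hX hu)
  have h3 := (uniqueDiffOn_Icc hδ 0 ⟨le_rfl, hδ.le⟩).eq_deriv _ h1.hasDerivWithinAt h2
  rw [lieDerivForm, h3, beta_eq_zero hX hu]
  simp

theorem symL_subset_sym (hL : ContDiffOn ℝ ∞ L (phaseSpace Q)) (hΩ : OmegaConstantRank Q L)
    {X : VF D} (hX : X ∈ sol Q L) : (symL Q L : Set (KerBarQuot Q L)) ⊆ sym Q L X := by
  rintro c hc P hP rfl u hu
  have hE := (cls_mem_symL_iff hL hP).1 hc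
  have h0 : (fun u => beta L X u (P u)) =ᶠ[𝓝 u] fun _ => 0 :=
    (eventually_mem_phaseSpace hu.1).mono fun u' hu' =>
      (beta_apply_of_mem_kerBar X hP hu').trans (hE u' hu')
  rw [lieDerivForm_beta hL hΩ hP.1 hP.2.1 hE hX hu, h0.fderiv_eq]
  simp

/-- On the constraint set, the bracket of a solution of the energy equation with a symmetry of `Ω_L`
and `E` lies in the kernel of `Ω_L`. -/
theorem omega_lieBracket_sol (hL : ContDiffOn ℝ ∞ L (phaseSpace Q)) (hΩ : OmegaConstantRank Q L)
    {P X : VF D} (hP : ContDiffOn ℝ ∞ P (phaseSpace Q))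
    (hk : ∀ u ∈ phaseSpace Q, omega L u (P u) = 0)
    (hE : ∀ u ∈ phaseSpace Q, fderiv ℝ (energy L) u (P u) = 0) (hX : X ∈ sol Q L) {u : Phase D}
    (hu : u ∈ constraintSet Q L) : omega L u (VectorField.lieBracket ℝ P X u) = 0 := by
  have h0 : (fun u => fderiv ℝ (energy L) u (P u)) =ᶠ[𝓝 u] fun _ => 0 :=
    (eventually_mem_phaseSpace hu.1).mono hE
  have h1 := lieDerivForm_fderiv_energy hL hu.1 (diffAt hP hu.1)
  rw [h0.fderiv_eq] at h1
  have hd1 := diffAt (smooth_fderiv (smooth_energy hL)) hu.1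
  have hd2 : DifferentiableAt ℝ (fun u => omega L u (X u)) u :=
    (diffAt (smooth_omega hL) hu.1).clm_apply (diffAt hX.1 hu.1)
  have h2 := lieDerivForm_beta hL hΩ hP hk hE hX hu
  rw [← lieDerivForm_omega hL hP hk hu.1 (diffAt hX.1 hu.1)]
  have h3 : lieDerivForm P (beta L X) u = lieDerivForm P (fderiv ℝ (energy L)) u -
      lieDerivForm P (fun u => omega L u (X u)) u := by
    have : HasFDerivAt (beta L X) _ u := hd1.hasFDerivAt.sub hd2.hasFDerivAt
    rw [lieDerivForm, this.fderiv, lieDerivForm, lieDerivForm, beta]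
    refine ContinuousLinearMap.ext fun y => ?_
    simp only [add_apply, sub_apply, ContinuousLinearMap.comp_apply]
    ring
  rw [h2, h1, fderiv_fun_const] at h3
  simpa using h3.symm

/-! ### Variations of the action -/

/-- The Euler-Lagrange expression `ρ · (∂L/∂q - d/dt ∂L/∂q̇)` at the point `u = (q, q̇)`, where `a`
stands for the acceleration `q̈`. -/
def eulerLagrange (L : Phase D → ℝ) (ρ : Phase D → Config D) (u : Phase D) (a : Config D) : ℝ :=
  fderiv ℝ L u (ρ u, 0) - fderiv ℝ (momentum L) u (u.2, a) (ρ u)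

theorem contDiff_deriv {F : Type*} [NormedAddCommGroup F] [NormedSpace ℝ F] {q : ℝ → F}
    (hq : ContDiff ℝ ∞ q) : ContDiff ℝ ∞ (deriv q) :=
  (contDiff_infty_iff_deriv.1 hq).2

theorem contDiff_lift {q : ℝ → Config D} (hq : ContDiff ℝ ∞ q) : ContDiff ℝ ∞ (lift q) :=
  hq.prodMk (contDiff_deriv hq)

theorem hasDerivAt_lift {q : ℝ → Config D} (hq : ContDiff ℝ ∞ q) (t : ℝ) :
    HasDerivAt (lift q) (deriv q t, deriv (deriv q) t) t :=
  (hq.differentiable (by simp) t).hasDerivAt.prodMk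
    ((contDiff_deriv hq).differentiable (by simp) t).hasDerivAt

theorem continuous_eulerLagrange (hL : ContDiffOn ℝ ∞ L (phaseSpace Q)) {ρ : Phase D → Config D}
    (hρ : ContDiffOn ℝ ∞ ρ (phaseSpace Q)) {q : ℝ → Config D} (hq : IsPath Q q) :
    Continuous fun t => eulerLagrange L ρ (lift q t) (deriv (deriv q) t) := by
  have hl := contDiff_lift hq.1
  have hm : ∀ t, lift q t ∈ phaseSpace Q := hq.2
  have h1 := (smooth_fderiv hL).comp_contDiff hl hm
  have h2 := (smooth_fderiv (smooth_momentum hL)).comp_contDiff hl hm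
  have h3 := hρ.comp_contDiff hl hm
  have h4 := contDiff_deriv hq.1
  exact ((h1.clm_apply (h3.prodMk contDiff_const)).sub
    ((h2.clm_apply (h4.prodMk (contDiff_deriv h4))).clm_apply h3)).continuous

/-- Integration by parts in the variation of the action. -/
theorem deltaAction_eq (hL : ContDiffOn ℝ ∞ L (phaseSpace Q)) {ρ : Phase D → Config D}
    (hρ : ContDiffOn ℝ ∞ ρ (phaseSpace Q)) (t₁ t₂ : ℝ) {q : ℝ → Config D} (hq : IsPath Q q) :
    deltaAction L t₁ t₂ ρ q =
      (∫ t in t₁..t₂, eulerLagrange L ρ (lift q t) (deriv (deriv q) t)) +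
      (momentum L (lift q t₂) (ρ (lift q t₂)) - momentum L (lift q t₁) (ρ (lift q t₁))) := by
  have hl := contDiff_lift hq.1
  have hm : ∀ t, lift q t ∈ phaseSpace Q := hq.2
  have hp := (smooth_momentum hL).comp_contDiff hl hm
  have hr := hρ.comp_contDiff hl hm
  have hr' : ∀ t, HasDerivAt (fun s => ρ (lift q s)) (deriv (fun s => ρ (lift q s)) t) t := fun t =>
    (hr.differentiable (by simp) t).hasDerivAt
  have hpr := hp.clm_apply hr
  have hderiv : ∀ t, HasDerivAt (fun t => momentum L (lift q t) (ρ (lift q t)))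
      (fderiv ℝ (momentum L) (lift q t) (deriv q t, deriv (deriv q) t) (ρ (lift q t)) +
        momentum L (lift q t) (deriv (fun s => ρ (lift q s)) t)) t := fun t =>
    ((diffAt (smooth_momentum hL) (hm t)).hasFDerivAt.comp_hasDerivAt t
      (hasDerivAt_lift hq.1 t)).clm_apply (hr' t)
  have hcont : Continuous fun t =>
      fderiv ℝ (momentum L) (lift q t) (deriv q t, deriv (deriv q) t) (ρ (lift q t)) +
        momentum L (lift q t) (deriv (fun s => ρ (lift q s)) t) := by
    have : (fun t =>
      fderiv ℝ (momentum L) (lift q t) (deriv q t, deriv (deriv q) t) (ρ (lift q t)) +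
        momentum L (lift q t) (deriv (fun s => ρ (lift q s)) t)) =
        deriv fun t => momentum L (lift q t) (ρ (lift q t)) := funext fun t => (hderiv t).deriv.symm
    rw [this]
    exact (contDiff_deriv hpr).continuous
  rw [← intervalIntegral.integral_eq_sub_of_hasDerivAt (fun t _ => hderiv t)
    (hcont.intervalIntegrable _ _), ← intervalIntegral.integral_add
    ((continuous_eulerLagrange hL hρ hq).intervalIntegrable _ _) (hcont.intervalIntegrable _ _)]
  refine intervalIntegral.integral_congr fun t _ => ?_
  have h2 : ∀ a b : Config D, fderiv ℝ L (lift q t) (a, b) =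
      fderiv ℝ L (lift q t) (a, 0) + fderiv ℝ L (lift q t) (0, b) := fun a b => by
    rw [← map_add]; simp
  simp only [eulerLagrange]
  rw [h2]
  simp [momentum, lift]
  ring

theorem isActionSymmetry_iff_integral (hL : ContDiffOn ℝ ∞ L (phaseSpace Q)) (t₁ t₂ : ℝ)
    (ρ : Phase D → Config D) :
    IsActionSymmetry Q L t₁ t₂ ρ ↔ ContDiffOn ℝ ∞ ρ (phaseSpace Q) ∧
      ∀ q, IsPath Q q →
        ∫ t in t₁..t₂, eulerLagrange L ρ (lift q t) (deriv (deriv q) t) = 0 := by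
  refine and_congr_right fun hρ => forall₂_congr fun q hq => ?_
  rw [deltaAction_eq hL hρ t₁ t₂ hq, add_eq_right]

/-- A continuous function whose integral over every translate of `[t₁, t₂]` vanishes takes the same
value at both end points. -/
theorem eq_of_forall_integral_translate_eq_zero {k : ℝ → ℝ} (hk : Continuous k) {t₁ t₂ : ℝ}
    (h : ∀ τ, ∫ t in t₁..t₂, k (t + τ) = 0) : k t₁ = k t₂ := by
  have hF : ∀ x, HasDerivAt (fun x => ∫ t in (0 : ℝ)..x, k t) (k x) x := fun x =>
    (hk.integral_hasStrictDerivAt 0 x).hasDerivAt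
  have hG : HasDerivAt (fun τ => (∫ t in (0 : ℝ)..(t₂ + τ), k t) - ∫ t in (0 : ℝ)..(t₁ + τ), k t)
      (k t₂ - k t₁) 0 := by
    have h1 := HasDerivAt.comp_const_add t₂ 0 (by simpa using hF t₂)
    have h2 := HasDerivAt.comp_const_add t₁ 0 (by simpa using hF t₁)
    exact h1.sub h2
  have h0 : (fun τ => (∫ t in (0 : ℝ)..(t₂ + τ), k t) - ∫ t in (0 : ℝ)..(t₁ + τ), k t) =
      fun _ => 0 := by
    funext τ
    rw [intervalIntegral.integral_interval_sub_left (hk.intervalIntegrable _ _)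
      (hk.intervalIntegrable _ _), ← intervalIntegral.integral_comp_add_right, h τ]
  rw [h0] at hG
  have := hG.unique (hasDerivAt_const _ _)
  linarith

/-- There are paths with prescribed position, velocity and acceleration at a time `t₁` that rest at
the initial position from shortly after `t₁` on. -/
theorem exists_path_with_jet {q₀ : Config D} (hq₀ : q₀ ∈ Q) (v a : Config D) {t₁ t₂ : ℝ}
    (ht : t₁ < t₂) :
    ∃ q, IsPath Q q ∧ lift q t₁ = (q₀, v) ∧ deriv (deriv q) t₁ = a ∧
      lift q t₂ = (q₀, 0) ∧ deriv (deriv q) t₂ = 0 := by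
  obtain ⟨R, hR, hball⟩ := Metric.isOpen_iff.1 Q.isOpen q₀ hq₀
  obtain ⟨δ, hδ, hδ1, hδt, hδR⟩ : ∃ δ > 0, δ ≤ 1 ∧ δ < t₂ - t₁ ∧ δ * (‖v‖ + ‖a‖) < R := by
    have hpos : 0 < ‖v‖ + ‖a‖ + 1 := by positivity
    refine ⟨min (min 1 ((t₂ - t₁) / 2)) (R / (‖v‖ + ‖a‖ + 1)), ?_, ?_, ?_, ?_⟩
    · exact lt_min (lt_min one_pos (by linarith)) (by positivity)
    · exact (min_le_left _ _).trans (min_le_left _ _)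
    · have := (min_le_left (min 1 ((t₂ - t₁) / 2)) (R / (‖v‖ + ‖a‖ + 1))).trans (min_le_right _ _)
      linarith
    · have h1 := min_le_right (min 1 ((t₂ - t₁) / 2)) (R / (‖v‖ + ‖a‖ + 1))
      calc _ ≤ R / (‖v‖ + ‖a‖ + 1) * (‖v‖ + ‖a‖) := by gcongr
        _ < R / (‖v‖ + ‖a‖ + 1) * (‖v‖ + ‖a‖ + 1) := by
            apply mul_lt_mul_of_pos_left _ (by positivity)
            linarith
        _ = R := by field_simp
  let χ : ContDiffBump (0 : ℝ) := ⟨δ / 2, δ, by linarith, by linarith⟩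
  have hχ : ContDiff ℝ ∞ (χ : ℝ → ℝ) := χ.contDiff
  let q : ℝ → Config D := fun t => q₀ + χ (t - t₁) • ((t - t₁) • v + ((t - t₁) ^ 2 / 2) • a)
  have hs : ContDiff ℝ ∞ fun t : ℝ => t - t₁ := contDiff_id.sub contDiff_const
  have hq : ContDiff ℝ ∞ q := contDiff_const.add ((hχ.comp hs).smul
    ((hs.smul contDiff_const).add (((hs.pow 2).div_const 2).smul contDiff_const)))
  have hmem : ∀ t, q t ∈ Q := by
    refine fun t => hball ?_
    rw [mem_ball_iff_norm]
    simp only [q, add_sub_cancel_left]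
    by_cases htδ : |t - t₁| < δ
    · rw [norm_smul, Real.norm_of_nonneg χ.nonneg]
      have h1 : ‖(t - t₁) • v + ((t - t₁) ^ 2 / 2) • a‖ ≤ δ * (‖v‖ + ‖a‖) := by
        refine (norm_add_le _ _).trans ?_
        rw [norm_smul, norm_smul, mul_add]
        have h2 : ‖(t - t₁) ^ 2 / 2‖ ≤ δ := by
          rw [Real.norm_of_nonneg (by positivity), ← sq_abs]
          nlinarith [abs_nonneg (t - t₁)]
        have h3 : ‖t - t₁‖ ≤ δ := by rw [Real.norm_eq_abs]; exact htδ.le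
        gcongr
      calc _ ≤ 1 * (δ * (‖v‖ + ‖a‖)) := by
            gcongr
            exact χ.le_one
        _ < R := by linarith
    · rw [χ.zero_of_le_dist (by rw [Real.dist_eq, sub_zero]; exact not_lt.1 htδ)]
      simpa using hR
  have hnear1 : q =ᶠ[𝓝 t₁] fun t => q₀ + ((t - t₁) • v + ((t - t₁) ^ 2 / 2) • a) := by
    have : ∀ᶠ t in 𝓝 t₁, dist t t₁ < δ / 2 := Metric.ball_mem_nhds _ (by linarith)
    filter_upwards [this] with t h
    have : χ (t - t₁) = 1 := χ.one_of_mem_closedBall (by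
      rw [Metric.mem_closedBall, Real.dist_eq, sub_zero, ← Real.dist_eq]; exact h.le)
    simp [q, this]
  have hnear2 : q =ᶠ[𝓝 t₂] fun _ => q₀ := by
    have : ∀ᶠ t in 𝓝 t₂, t₁ + δ < t := lt_mem_nhds (by linarith)
    filter_upwards [this] with t h
    have : χ (t - t₁) = 0 := χ.zero_of_le_dist (by
      rw [Real.dist_eq, sub_zero]; exact le_trans (by show δ ≤ t - t₁; linarith) (le_abs_self _))
    simp [q, this]
  have hd1 : ∀ t, HasDerivAt (fun t => q₀ + ((t - t₁) • v + ((t - t₁) ^ 2 / 2) • a))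
      (v + (t - t₁) • a) t := by
    intro t
    have e1 : HasDerivAt (fun t : ℝ => t - t₁) 1 t := (hasDerivAt_id t).sub_const _
    have e2 : HasDerivAt (fun t : ℝ => (t - t₁) ^ 2 / 2) (t - t₁) t := by
      have := (e1.pow 2).div_const 2
      simpa using this
    have := ((e1.smul_const v).add (e2.smul_const a)).const_add q₀
    simpa using this
  have hd2 : ∀ t, HasDerivAt (fun t => v + (t - t₁) • a) a t := by
    intro t
    have e1 : HasDerivAt (fun t : ℝ => t - t₁) 1 t := (hasDerivAt_id t).sub_const _
    simpa using (e1.smul_const a).const_add v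
  have hD1 : deriv (fun t => q₀ + ((t - t₁) • v + ((t - t₁) ^ 2 / 2) • a)) =
      fun t => v + (t - t₁) • a := funext fun t => (hd1 t).deriv
  have hdn1 := hnear1.deriv
  rw [hD1] at hdn1
  have hdn2 := hnear2.deriv
  rw [deriv_const'] at hdn2
  refine ⟨q, ⟨hq, hmem⟩, ?_, ?_, ?_, ?_⟩
  · refine Prod.ext ?_ ?_
    · simp [lift, hnear1.eq_of_nhds]
    · simp [lift, hdn1.eq_of_nhds]
  · rw [hdn1.deriv_eq, (hd2 t₁).deriv]
  · refine Prod.ext ?_ ?_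
    · simp [lift, hnear2.eq_of_nhds]
    · simp [lift, hdn2.eq_of_nhds]
  · rw [hdn2.deriv_eq, deriv_const]

/-- The integral condition localizes: `ρ` generates a symmetry of the action exactly if the
Euler-Lagrange expression vanishes for all positions, velocities and accelerations. -/
theorem isActionSymmetry_iff_eulerLagrange (hL : ContDiffOn ℝ ∞ L (phaseSpace Q)) {t₁ t₂ : ℝ}
    (ht : t₁ < t₂) (ρ : Phase D → Config D) :
    IsActionSymmetry Q L t₁ t₂ ρ ↔ ContDiffOn ℝ ∞ ρ (phaseSpace Q) ∧
      ∀ u ∈ phaseSpace Q, ∀ a, eulerLagrange L ρ u a = 0 := by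
  rw [isActionSymmetry_iff_integral hL]
  refine and_congr_right fun hρ => ⟨fun h u hu a => ?_, fun h q hq => ?_⟩
  · -- A path that rests at `u.1` has zero integral, so the expression vanishes at rest.
    have hrest : eulerLagrange L ρ (u.1, 0) 0 = 0 := by
      have h1 := h (fun _ => u.1) ⟨contDiff_const, fun _ => hu⟩
      have h2 : ∀ t, lift (fun _ : ℝ => u.1) t = (u.1, 0) := fun t => by simp [lift]
      simp only [h2, deriv_const', intervalIntegral.integral_const, smul_eq_mul] at h1
      exact (mul_eq_zero.1 h1).resolve_left (by linarith)
    obtain ⟨q, hq, e1, e2, e3, e4⟩ := exists_path_with_jet (Q := Q) hu u.2 a ht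
    have hk := eq_of_forall_integral_translate_eq_zero (t₁ := t₁) (t₂ := t₂)
      (continuous_eulerLagrange hL hρ hq) fun τ => by
        have hd : ∀ f : ℝ → Config D, deriv (fun t => f (t + τ)) = fun t => deriv f (t + τ) :=
          fun f => funext fun t => deriv_comp_add_const f τ t
        have h1 := h (fun t => q (t + τ)) ⟨hq.1.comp (contDiff_id.add contDiff_const),
          fun t => hq.2 (t + τ)⟩
        simpa only [lift, hd] using h1
    rw [e1, e2, e3, e4, hrest] at hk
    exact hk
  · have h2 : ∀ t, eulerLagrange L ρ (lift q t) (deriv (deriv q) t) = 0 := fun t =>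
      h _ (hq.2 t) _
    simp [h2]

theorem fderiv_momentum_split (u : Phase D) (b c : Config D) :
    fderiv ℝ (momentum L) u (b, c) = fderiv ℝ (momentum L) u (b, 0) + hessian L u c := by
  rw [hessian_apply, ← map_add]; simp

theorem eulerLagrange_of_omega_eq_zero (hL : ContDiffOn ℝ ∞ L (phaseSpace Q)) {P : VF D}
    {u : Phase D} (hu : u ∈ phaseSpace Q) (hP : omega L u (P u) = 0) (a : Config D) :
    eulerLagrange L (fun u => (P u).1) u a = -fderiv ℝ (energy L) u (P u) := by
  have h1 := congrArg (fun φ : Phase D →L[ℝ] ℝ => φ (u.2, 0)) hP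
  simp only [omega_apply_momentum hL hu, zero_apply] at h1
  have h2 := hessian_fst_eq_zero hL hu hP
  rw [eulerLagrange, fderiv_momentum_split, fderiv_energy_apply hL hu, add_apply,
    hessian_symm hL hu, h2, zero_apply]
  linarith

theorem cls_mem_symL_iff_isActionSymmetry (hL : ContDiffOn ℝ ∞ L (phaseSpace Q)) {t₁ t₂ : ℝ}
    (ht : t₁ < t₂) {P : VF D} (hP : P ∈ kerBar Q L) :
    cls P hP ∈ symL Q L ↔ IsActionSymmetry Q L t₁ t₂ (fun u => (P u).1) := by
  rw [cls_mem_symL_iff hL hP, isActionSymmetry_iff_eulerLagrange hL ht]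
  constructor
  · intro h
    refine ⟨contDiff_fst.comp_contDiffOn hP.1, fun u hu a => ?_⟩
    rw [eulerLagrange_of_omega_eq_zero hL hu (hP.2.1 u hu), h u hu, neg_zero]
  · rintro ⟨_, h⟩ u hu
    have := h u hu 0
    rwa [eulerLagrange_of_omega_eq_zero hL hu (hP.2.1 u hu), neg_eq_zero] at this

/-! ### Lifting a symmetry of the action to the phase space -/

/-- The covector `b ↦ b^c (∂_c p_a) ρ^a - ρ^c (∂_c p_a) b^a` with `p = ∂L/∂v`. A vector `(ρ, η)`
with `M ρ = 0` lies in the kernel of `Ω_L` exactly if `M η` is this covector. -/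
def liftObstruction (L : Phase D → ℝ) (ρ : Phase D → Config D) (u : Phase D) :
    Config D →L[ℝ] ℝ :=
  (fderiv ℝ (momentum L) u ∘L ContinuousLinearMap.inl ℝ (Config D) (Config D)).flip (ρ u) -
    fderiv ℝ (momentum L) u (ρ u, 0)

theorem liftObstruction_apply (ρ : Phase D → Config D) (u : Phase D) (b : Config D) :
    liftObstruction L ρ u b =
      fderiv ℝ (momentum L) u (b, 0) (ρ u) - fderiv ℝ (momentum L) u (ρ u, 0) b := by
  simp [liftObstruction]

theorem smooth_liftObstruction (hL : ContDiffOn ℝ ∞ L (phaseSpace Q)) {ρ : Phase D → Config D}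
    (hρ : ContDiffOn ℝ ∞ ρ (phaseSpace Q)) :
    ContDiffOn ℝ ∞ (liftObstruction L ρ) (phaseSpace Q) := by
  have h := smooth_fderiv (smooth_momentum hL)
  exact ((contDiff_flip.comp_contDiffOn (h.clm_comp contDiffOn_const)).clm_apply hρ).sub
    (h.clm_apply (hρ.prodMk contDiffOn_const))

/-- The obstruction vanishes on `ker M`: differentiate `v · ∂p/∂q · ρ = ∂L/∂q · ρ` in the direction
of a gauge vector `(0, z)` along which `ρ` is constant. -/
theorem liftObstruction_apply_eq_zero (hL : ContDiffOn ℝ ∞ L (phaseSpace Q))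
    {ρ : Phase D → Config D} (hρ : ContDiffOn ℝ ∞ ρ (phaseSpace Q))
    (hEL : ∀ u ∈ phaseSpace Q, ∀ a, eulerLagrange L ρ u a = 0) {u : Phase D}
    (hu : u ∈ phaseSpace Q) {z : Config D} (hz : hessian L u z = 0)
    (hρz : fderiv ℝ ρ u (0, z) = 0) : liftObstruction L ρ u z = 0 := by
  have hp := smooth_momentum hL
  have hDp := diffAt (smooth_fderiv hp) hu
  have hMρ : ∀ u ∈ phaseSpace Q, ∀ a, hessian L u a (ρ u) = 0 := fun u hu a => by
    have h1 := hEL u hu a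
    have h2 := hEL u hu 0
    rw [eulerLagrange, fderiv_momentum_split, add_apply] at h1
    rw [eulerLagrange] at h2
    linarith
  -- The derivative of `M ρ = 0` in the direction `(v, 0)`, paired with `z`.
  have h1 : fderiv ℝ (fderiv ℝ (momentum L)) u (u.2, 0) (0, z) (ρ u) = 0 := by
    have h := ((hDp.hasFDerivAt.clm_apply (hasFDerivAt_const ((0, z) : Phase D) u)).clm_apply
      (diffAt hρ hu).hasFDerivAt).fderiv
    have h0 : (fun u => fderiv ℝ (momentum L) u (0, z) (ρ u)) =ᶠ[𝓝 u] fun _ => 0 :=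
      (eventually_mem_phaseSpace hu).mono fun u' hu' => hMρ u' hu' z
    rw [h0.fderiv_eq, fderiv_fun_const] at h
    have h2 := congrArg (fun φ : Phase D →L[ℝ] ℝ => φ (u.2, 0)) h
    have h3 : fderiv ℝ (momentum L) u (0, z) = 0 := hz
    simpa [h3] using h2.symm
  -- The derivative of `v · ∂p/∂q · ρ = ∂L/∂q · ρ` in the direction `(0, z)`.
  have h2 : fderiv ℝ (fderiv ℝ (momentum L)) u (0, z) (u.2, 0) (ρ u) +
      fderiv ℝ (momentum L) u (z, 0) (ρ u) = fderiv ℝ (fderiv ℝ L) u (0, z) (ρ u, 0) := by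
    have hv : HasFDerivAt (fun u : Phase D => ((u.2, 0) : Phase D)) _ u :=
      (hasFDerivAt_snd (𝕜 := ℝ) (E := Config D) (F := Config D) (p := u)).prodMk
        (hasFDerivAt_const (0 : Config D) u)
    have hr : HasFDerivAt (fun u : Phase D => ((ρ u, 0) : Phase D)) _ u :=
      (diffAt hρ hu).hasFDerivAt.prodMk (hasFDerivAt_const (0 : Config D) u)
    have hl := ((hDp.hasFDerivAt.clm_apply hv).clm_apply (diffAt hρ hu).hasFDerivAt).sub
      ((diffAt (smooth_fderiv hL) hu).hasFDerivAt.clm_apply hr)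
    have h0 : ((fun u => fderiv ℝ (momentum L) u (u.2, 0) (ρ u)) -
        fun u => fderiv ℝ L u (ρ u, 0)) =ᶠ[𝓝 u] fun _ => 0 :=
      (eventually_mem_phaseSpace hu).mono fun u' hu' => by
        have := hEL u' hu' 0
        rw [eulerLagrange] at this
        show fderiv ℝ (momentum L) u' (u'.2, 0) (ρ u') - fderiv ℝ L u' (ρ u', 0) = 0
        linarith
    have h3 := hl.fderiv
    rw [h0.fderiv_eq, fderiv_fun_const] at h3
    have h4 := congrArg (fun φ : Phase D →L[ℝ] ℝ => φ (0, z)) h3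
    simp only [Pi.zero_apply, zero_apply, sub_apply, add_apply, ContinuousLinearMap.comp_apply,
      ContinuousLinearMap.flip_apply, hρz, map_zero, ContinuousLinearMap.prod_apply,
      Prod.mk_zero_zero, zero_add, ContinuousLinearMap.coe_snd'] at h4
    linarith
  rw [fderiv_fderiv_comm (smoothAt hp hu), h1, fderiv_fderiv_comm (smoothAt hL hu),
    ← fderiv_momentum_apply hL hu, zero_add] at h2
  rw [liftObstruction_apply, h2, sub_self]

/-- A covector field that vanishes on `ker M` is smoothly in the image of `M`. -/
theorem exists_hessian_eq (hL : ContDiffOn ℝ ∞ L (phaseSpace Q)) (hM : HessianConstantRank Q L)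
    {w : Phase D → Config D →L[ℝ] ℝ} (hw : ContDiffOn ℝ ∞ w (phaseSpace Q))
    (hw0 : ∀ u ∈ phaseSpace Q, ∀ z, hessian L u z = 0 → w u z = 0) :
    ∃ η : Phase D → Config D, ContDiffOn ℝ ∞ η (phaseSpace Q) ∧
      ∀ u ∈ phaseSpace Q, hessian L u (η u) = w u := by
  obtain ⟨J, hJ, hJ'⟩ := exists_hessian_generalizedInverse hL hM
  set e : (Config D →L[ℝ] ℝ) ≃L[ℝ] Config D :=
    (InnerProductSpace.toDual ℝ (Config D)).symm.toContinuousLinearEquiv with he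
  have hin : ∀ (φ : Config D →L[ℝ] ℝ) (y : Config D), inner ℝ (e φ) y = φ y := fun φ y =>
    InnerProductSpace.toDual_symm_apply
  -- `η` represents the functional `φ ↦ w (J φ)` on covectors, the transpose of `J` applied to `w`.
  refine ⟨fun u => e (w u ∘L J u ∘L (e.symm : Config D →L[ℝ] Config D →L[ℝ] ℝ)),
    e.contDiff.comp_contDiffOn (hw.clm_comp (hJ.clm_comp contDiffOn_const)), fun u hu => ?_⟩
  refine ContinuousLinearMap.ext fun y => ?_
  rw [hessian_symm hL hu, ← hin (hessian L u y), real_inner_comm, hin]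
  have h1 : w u (y - J u (hessian L u y)) = 0 := hw0 u hu _ (by rw [map_sub, hJ' u hu, sub_self])
  rw [map_sub, sub_eq_zero] at h1
  simp [h1]

theorem exists_lift_mem_kerBar (hL : ContDiffOn ℝ ∞ L (phaseSpace Q))
    (hM : HessianConstantRank Q L) {ρ : Phase D → Config D}
    (hρ : ContDiffOn ℝ ∞ ρ (phaseSpace Q))
    (hEL : ∀ u ∈ phaseSpace Q, ∀ a, eulerLagrange L ρ u a = 0)
    (hG : ∀ G ∈ gauge Q L, ∀ u ∈ phaseSpace Q, fderiv ℝ ρ u (G u) = 0) :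
    ∃ η : Phase D → Config D, (fun u => (ρ u, η u)) ∈ kerBar Q L := by
  obtain ⟨η, hη, hη'⟩ := exists_hessian_eq hL hM (smooth_liftObstruction hL hρ) fun u hu z hz => by
    obtain ⟨G, hGg, hGu⟩ := exists_gauge_apply_eq hL hM hu hz
    exact liftObstruction_apply_eq_zero hL hρ hEL hu hz (hGu ▸ hG G hGg u hu)
  have hP : ContDiffOn ℝ ∞ (fun u => (ρ u, η u)) (phaseSpace Q) := hρ.prodMk hη
  refine ⟨η, hP, fun u hu => ContinuousLinearMap.ext fun y => ?_, fun G hGg u hu => ?_⟩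
  · have h1 := hEL u hu y.2
    have h2 := hEL u hu 0
    have h3 := congrArg (fun φ : Config D →L[ℝ] ℝ => φ y.1) (hη' u hu)
    rw [eulerLagrange, fderiv_momentum_split, add_apply] at h1
    rw [eulerLagrange] at h2
    simp only [liftObstruction_apply] at h3
    rw [omega_apply_momentum hL hu, fderiv_momentum_split u (ρ u) (η u),
      show y = (y.1, y.2) from rfl, fderiv_momentum_split, add_apply, add_apply, zero_apply]
    simp only
    linarith
  · have h1 := fderiv_apply_fst (diffAt hP hu) (G u)
    rw [VectorField.lieBracket, Prod.fst_sub, fderiv_gauge_fst hGg hu, sub_zero, h1]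
    exact hG G hGg u hu

theorem cls_eq_of_fst_eq (hL : ContDiffOn ℝ ∞ L (phaseSpace Q)) {P P' : VF D}
    (hP : P ∈ kerBar Q L) (hP' : P' ∈ kerBar Q L)
    (h : ∀ u ∈ phaseSpace Q, (P u).1 = (P' u).1) : cls P hP = cls P' hP' := by
  refine (Submodule.Quotient.eq _).2 ?_
  have hsub := sub_mem hP hP'
  refine ⟨hsub.1, fun u hu => ?_⟩
  have h1 : ((P - P') u).1 = 0 := by simp [h u hu]
  exact ⟨h1, (omega_vertical_eq_zero_iff hL hu h1).1 (hsub.2.1 u hu)⟩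

theorem existsUnique_class_of_isActionSymmetry (hL : ContDiffOn ℝ ∞ L (phaseSpace Q))
    (hM : HessianConstantRank Q L) {t₁ t₂ : ℝ} (ht : t₁ < t₂) {ρ : Phase D → Config D}
    (hρ : IsActionSymmetry Q L t₁ t₂ ρ)
    (hG : ∀ G ∈ gauge Q L, ∀ u ∈ phaseSpace Q, fderiv ℝ ρ u (G u) = 0) :
    ∃! c : KerBarQuot Q L, c ∈ symL Q L ∧
      ∃ (P : VF D) (hP : P ∈ kerBar Q L), cls P hP = c ∧ ∀ u ∈ phaseSpace Q, (P u).1 = ρ u := by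
  have hEL := (isActionSymmetry_iff_eulerLagrange hL ht ρ).1 hρ
  obtain ⟨η, hη⟩ := exists_lift_mem_kerBar hL hM hEL.1 hEL.2 hG
  refine ⟨cls _ hη, ⟨(cls_mem_symL_iff_isActionSymmetry hL ht hη).2 hρ, _, hη, rfl,
    fun _ _ => rfl⟩, ?_⟩
  rintro c ⟨_, P, hP, rfl, h⟩
  exact cls_eq_of_fst_eq hL hP hη h

theorem grSymL_eq_actionSymmetryGroup (hL : ContDiffOn ℝ ∞ L (phaseSpace Q)) {t₁ t₂ : ℝ}
    (ht : t₁ < t₂) : grSymL Q L = actionSymmetryGroup Q L t₁ t₂ := by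
  refine congrArg (flowGroup Q) (Set.ext fun P => ?_)
  constructor
  · rintro ⟨hP, h⟩
    exact ⟨hP, (cls_mem_symL_iff_isActionSymmetry hL ht hP).1 h⟩
  · rintro ⟨hP, h⟩
    exact ⟨hP, (cls_mem_symL_iff_isActionSymmetry hL ht hP).2 h⟩

/-! ### Flows and their derivatives -/

section MixedDerivatives

variable {V : Type*} [NormedAddCommGroup V] [NormedSpace ℝ V]

theorem hasDerivAt_clm_comp_apply {W : Type*} [NormedAddCommGroup W] [NormedSpace ℝ W]
    {A : W → W →L[ℝ] V} {A' : W →L[ℝ] W →L[ℝ] V} {c : ℝ → W} {c' : W} {s : ℝ}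
    (hA : HasFDerivAt A A' (c s)) (hc : HasDerivAt c c' s) (y : W) :
    HasDerivAt (fun s => A (c s) y) (A' c' y) s := by
  have h := (hA.comp_hasDerivAt s hc).clm_apply (hasDerivAt_const s y)
  simpa using h

/-- Exchange of the time derivative and a spatial derivative: if `∂Ψ/∂s = g` near `u`, then
`∂/∂s (∂Ψ/∂u · x) = Dg · x`. -/
theorem hasDerivAt_fderiv_apply {Ψ : ℝ × V → V} {s : ℝ} {u : V} (hΨ : ContDiffAt ℝ ∞ Ψ (s, u))
    {g : V → V} {g' : V →L[ℝ] V} (hg : HasFDerivAt g g' u)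
    (hΨg : ∀ᶠ u' in 𝓝 u, HasDerivAt (fun s => Ψ (s, u')) (g u') s) (x : V) :
    HasDerivAt (fun s => fderiv ℝ Ψ (s, u) (0, x)) (g' x) s := by
  have hΨd : HasFDerivAt (fderiv ℝ Ψ) (fderiv ℝ (fderiv ℝ Ψ) (s, u)) (s, u) :=
    ((hΨ.fderiv_right (m := ∞) (by simp)).differentiableAt (by simp)).hasFDerivAt
  have hcs : HasDerivAt (fun s : ℝ => (s, u)) ((1, 0) : ℝ × V) s :=
    (hasDerivAt_id s).prodMk (hasDerivAt_const s u)
  have hcu : HasFDerivAt (fun u : V => (s, u)) (ContinuousLinearMap.inr ℝ ℝ V) u :=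
    (hasFDerivAt_const s u).prodMk (hasFDerivAt_id u)
  have h1 := hasDerivAt_clm_comp_apply (c := fun s => (s, u)) hΨd hcs (0, x)
  have e1 := (hΨd.comp u hcu).clm_apply (hasFDerivAt_const ((1, 0) : ℝ × V) u)
  have hd : ∀ᶠ p in 𝓝 (s, u), DifferentiableAt ℝ Ψ p :=
    ((hΨ.of_le two_le_smooth).eventually (by decide)).mono fun p hp =>
      hp.differentiableAt (by decide)
  have e2 : g =ᶠ[𝓝 u] fun u => fderiv ℝ Ψ (s, u) (1, 0) := by
    filter_upwards [hΨg, hcu.continuousAt.eventually hd] with u' h h'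
    have hc : HasDerivAt (fun s : ℝ => (s, u')) ((1, 0) : ℝ × V) s :=
      (hasDerivAt_id s).prodMk (hasDerivAt_const s u')
    exact h.unique (h'.hasFDerivAt.comp_hasDerivAt s hc)
  have e3 := congrArg (fun φ : V →L[ℝ] V => φ x)
    ((e1.congr_of_eventuallyEq e2).unique hg)
  have e4 : fderiv ℝ (fderiv ℝ Ψ) (s, u) (1, 0) (0, x) = g' x := by
    rw [fderiv_fderiv_comm hΨ]
    simpa using e3
  rwa [e4] at h1

end MixedDerivatives

/-- Integral curves in the phase space that agree at time `0` agree at all times. -/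
theorem eq_of_integralCurve {P : VF D} (hP : ContDiffOn ℝ ∞ P (phaseSpace Q)) {c₁ c₂ : ℝ → Phase D}
    (h₁ : ∀ s, c₁ s ∈ phaseSpace Q ∧ HasDerivAt c₁ (P (c₁ s)) s)
    (h₂ : ∀ s, c₂ s ∈ phaseSpace Q ∧ HasDerivAt c₂ (P (c₂ s)) s) (h0 : c₁ 0 = c₂ 0) (s : ℝ) :
    c₁ s = c₂ s := by
  have hc₁ : Continuous c₁ := continuous_iff_continuousAt.2 fun s => (h₁ s).2.continuousAt
  have hc₂ : Continuous c₂ := continuous_iff_continuousAt.2 fun s => (h₂ s).2.continuousAt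
  have hclopen : IsClopen {s | c₁ s = c₂ s} := by
    refine ⟨isClosed_eq hc₁ hc₂, isOpen_iff_mem_nhds.2 fun s hs => ?_⟩
    obtain ⟨K, t, ht, hK⟩ := ((smoothAt hP (h₁ s).1).of_le
      (show (1 : WithTop ℕ∞) ≤ ∞ by simp)).exists_lipschitzOnWith
    have ht' : t ∈ 𝓝 (c₂ s) := by
      have hs' : c₁ s = c₂ s := hs
      rwa [← hs']
    exact ODE_solution_unique_of_eventually (v := fun _ => P) (s := fun _ => t)
      (Filter.Eventually.of_forall fun _ => hK)
      ((hc₁.continuousAt.eventually ht).mono fun s' hs' => ⟨(h₁ s').2, hs'⟩)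
      ((hc₂.continuousAt.eventually ht').mono fun s' hs' => ⟨(h₂ s').2, hs'⟩) hs
  have := hclopen.eq_univ ⟨0, h0⟩
  exact (Set.eq_univ_iff_forall.1 this) s

namespace IsFlow

variable {P : VF D} {Φ : ℝ → Phase D → Phase D}

theorem mem (hΦ : IsFlow Q P Φ) {u : Phase D} (hu : u ∈ phaseSpace Q) (s : ℝ) :
    Φ s u ∈ phaseSpace Q :=
  ((hΦ.2 u hu).2 s).1

theorem zero_apply (hΦ : IsFlow Q P Φ) {u : Phase D} (hu : u ∈ phaseSpace Q) : Φ 0 u = u :=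
  (hΦ.2 u hu).1

theorem hasDerivAt (hΦ : IsFlow Q P Φ) {u : Phase D} (hu : u ∈ phaseSpace Q) (s : ℝ) :
    HasDerivAt (fun s => Φ s u) (P (Φ s u)) s :=
  ((hΦ.2 u hu).2 s).2

theorem smoothAt_uncurry (hΦ : IsFlow Q P Φ) {u : Phase D} (hu : u ∈ phaseSpace Q) (s : ℝ) :
    ContDiffAt ℝ ∞ (fun p : ℝ × Phase D => Φ p.1 p.2) (s, u) :=
  hΦ.1.contDiffAt ((isOpen_univ.prod (isOpen_phaseSpace Q)).mem_nhds ⟨mem_univ _, hu⟩)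

theorem smooth (hΦ : IsFlow Q P Φ) (s : ℝ) : ContDiffOn ℝ ∞ (Φ s) (phaseSpace Q) := fun u hu =>
  ((hΦ.smoothAt_uncurry hu s).comp u (contDiffAt_const.prodMk contDiffAt_id)).contDiffWithinAt

theorem add_apply (hΦ : IsFlow Q P Φ) (hP : ContDiffOn ℝ ∞ P (phaseSpace Q)) {u : Phase D}
    (hu : u ∈ phaseSpace Q) (s t : ℝ) : Φ s (Φ t u) = Φ (s + t) u := by
  refine eq_of_integralCurve hP (c₁ := fun s => Φ s (Φ t u)) (c₂ := fun s => Φ (s + t) u)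
    (fun s => ⟨hΦ.mem (hΦ.mem hu t) s, hΦ.hasDerivAt (hΦ.mem hu t) s⟩)
    (fun s => ⟨hΦ.mem hu (s + t), HasDerivAt.comp_add_const s t (hΦ.hasDerivAt hu (s + t))⟩) ?_ s
  simp only [zero_add]
  exact hΦ.zero_apply (hΦ.mem hu t)

theorem neg_apply (hΦ : IsFlow Q P Φ) (hP : ContDiffOn ℝ ∞ P (phaseSpace Q)) {u : Phase D}
    (hu : u ∈ phaseSpace Q) (s : ℝ) : Φ (-s) (Φ s u) = u := by
  rw [hΦ.add_apply hP hu, neg_add_cancel, hΦ.zero_apply hu]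

theorem apply_neg (hΦ : IsFlow Q P Φ) (hP : ContDiffOn ℝ ∞ P (phaseSpace Q)) {u : Phase D}
    (hu : u ∈ phaseSpace Q) (s : ℝ) : Φ s (Φ (-s) u) = u := by
  rw [hΦ.add_apply hP hu, add_neg_cancel, hΦ.zero_apply hu]

theorem fderiv_zero (hΦ : IsFlow Q P Φ) {u : Phase D} (hu : u ∈ phaseSpace Q) (x : Phase D) :
    fderiv ℝ (Φ 0) u x = x := by
  have h : Φ 0 =ᶠ[𝓝 u] id := (eventually_mem_phaseSpace hu).mono fun u' hu' => hΦ.zero_apply hu'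
  rw [h.fderiv_eq, fderiv_id]
  rfl

theorem fderiv_neg_apply (hΦ : IsFlow Q P Φ) (hP : ContDiffOn ℝ ∞ P (phaseSpace Q)) {u : Phase D}
    (hu : u ∈ phaseSpace Q) (s : ℝ) (x : Phase D) :
    fderiv ℝ (Φ (-s)) (Φ s u) (fderiv ℝ (Φ s) u x) = x := by
  have h : Φ (-s) ∘ Φ s =ᶠ[𝓝 u] id :=
    (eventually_mem_phaseSpace hu).mono fun u' hu' => hΦ.neg_apply hP hu' s
  have h2 := fderiv_comp u (diffAt (hΦ.smooth (-s)) (hΦ.mem hu s)) (diffAt (hΦ.smooth s) hu)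
  rw [h.fderiv_eq, fderiv_id] at h2
  exact (congrArg (fun φ : Phase D →L[ℝ] Phase D => φ x) h2).symm

theorem fderiv_apply_neg (hΦ : IsFlow Q P Φ) (hP : ContDiffOn ℝ ∞ P (phaseSpace Q)) {u : Phase D}
    (hu : u ∈ phaseSpace Q) (s : ℝ) (x : Phase D) :
    fderiv ℝ (Φ s) (Φ (-s) u) (fderiv ℝ (Φ (-s)) u x) = x := by
  simpa using hΦ.fderiv_neg_apply hP hu (-s) x

theorem fderiv_eq_uncurry (hΦ : IsFlow Q P Φ) {u : Phase D} (hu : u ∈ phaseSpace Q) (s : ℝ)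
    (x : Phase D) :
    fderiv ℝ (Φ s) u x = fderiv ℝ (fun p : ℝ × Phase D => Φ p.1 p.2) (s, u) (0, x) := by
  have h := ((hΦ.smoothAt_uncurry hu s).differentiableAt (by simp)).hasFDerivAt.comp u
    ((hasFDerivAt_const s u).prodMk (hasFDerivAt_id u))
  have h2 : HasFDerivAt (Φ s) _ u := h
  rw [h2.fderiv]
  simp

/-- The derivative of the flow satisfies the linearized equation. -/
theorem hasDerivAt_fderiv (hΦ : IsFlow Q P Φ) (hP : ContDiffOn ℝ ∞ P (phaseSpace Q)) {u : Phase D}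
    (hu : u ∈ phaseSpace Q) (x : Phase D) (s : ℝ) :
    HasDerivAt (fun s => fderiv ℝ (Φ s) u x) (fderiv ℝ P (Φ s u) (fderiv ℝ (Φ s) u x)) s := by
  have h := hasDerivAt_fderiv_apply (hΦ.smoothAt_uncurry hu s)
    ((diffAt hP (hΦ.mem hu s)).hasFDerivAt.comp u (diffAt (hΦ.smooth s) hu).hasFDerivAt)
    ((eventually_mem_phaseSpace hu).mono fun u' hu' => hΦ.hasDerivAt hu' s) x
  have he : (fun s => fderiv ℝ (fun p : ℝ × Phase D => Φ p.1 p.2) (s, u) (0, x)) =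
      fun s => fderiv ℝ (Φ s) u x := funext fun s' => (hΦ.fderiv_eq_uncurry hu s' x).symm
  rw [he] at h
  exact h

/-! ### Invariants of the flows of symmetries -/

theorem omega_fderiv (hΦ : IsFlow Q P Φ) (hL : ContDiffOn ℝ ∞ L (phaseSpace Q))
    (hP : ContDiffOn ℝ ∞ P (phaseSpace Q)) (hk : ∀ u ∈ phaseSpace Q, omega L u (P u) = 0)
    {u : Phase D} (hu : u ∈ phaseSpace Q) (s : ℝ) (x y : Phase D) :
    omega L (Φ s u) (fderiv ℝ (Φ s) u x) (fderiv ℝ (Φ s) u y) = omega L u x y := by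
  have hd : ∀ s, HasDerivAt
      (fun s => omega L (Φ s u) (fderiv ℝ (Φ s) u x) (fderiv ℝ (Φ s) u y)) 0 s := fun s => by
    have h1 := HasFDerivAt.comp_hasDerivAt (f := fun s => Φ s u) s
      (diffAt (smooth_omega hL) (hΦ.mem hu s)).hasFDerivAt (hΦ.hasDerivAt hu s)
    have h2 := (h1.clm_apply (hΦ.hasDerivAt_fderiv hP hu x s)).clm_apply
      (hΦ.hasDerivAt_fderiv hP hu y s)
    have h3 := lieDeriv_omega hL hP hk (hΦ.mem hu s) (fderiv ℝ (Φ s) u x) (fderiv ℝ (Φ s) u y)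
    refine h2.congr_deriv ?_
    rw [_root_.add_apply]
    exact h3
  have h0 := is_const_of_deriv_eq_zero (fun s => (hd s).differentiableAt)
    (fun s => (hd s).deriv) s 0
  simp only [hΦ.zero_apply hu, hΦ.fderiv_zero hu] at h0
  exact h0

theorem energy_apply (hΦ : IsFlow Q P Φ) (hL : ContDiffOn ℝ ∞ L (phaseSpace Q))
    (hE : ∀ u ∈ phaseSpace Q, fderiv ℝ (energy L) u (P u) = 0)
    {u : Phase D} (hu : u ∈ phaseSpace Q) (s : ℝ) : energy L (Φ s u) = energy L u := by
  have hd : ∀ s, HasDerivAt (fun s => energy L (Φ s u)) 0 s := fun s => by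
    have h1 := HasFDerivAt.comp_hasDerivAt (f := fun s => Φ s u) s
      (diffAt (smooth_energy hL) (hΦ.mem hu s)).hasFDerivAt (hΦ.hasDerivAt hu s)
    rwa [hE _ (hΦ.mem hu s)] at h1
  have h0 := is_const_of_deriv_eq_zero (fun s => (hd s).differentiableAt)
    (fun s => (hd s).deriv) s 0
  simp only [hΦ.zero_apply hu] at h0
  exact h0

theorem fderiv_energy (hΦ : IsFlow Q P Φ) (hL : ContDiffOn ℝ ∞ L (phaseSpace Q))
    (hE : ∀ u ∈ phaseSpace Q, fderiv ℝ (energy L) u (P u) = 0)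
    {u : Phase D} (hu : u ∈ phaseSpace Q) (s : ℝ) (x : Phase D) :
    fderiv ℝ (energy L) (Φ s u) (fderiv ℝ (Φ s) u x) = fderiv ℝ (energy L) u x := by
  have h : energy L ∘ Φ s =ᶠ[𝓝 u] energy L :=
    (eventually_mem_phaseSpace hu).mono fun u' hu' => hΦ.energy_apply hL hE hu' s
  have h2 := fderiv_comp u (diffAt (smooth_energy hL) (hΦ.mem hu s)) (diffAt (hΦ.smooth s) hu)
  rw [h.fderiv_eq] at h2
  exact (congrArg (fun φ : Phase D →L[ℝ] ℝ => φ x) h2).symm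

theorem mem_constraintSet (hΦ : IsFlow Q P Φ) (hL : ContDiffOn ℝ ∞ L (phaseSpace Q))
    (hP : ContDiffOn ℝ ∞ P (phaseSpace Q)) (hk : ∀ u ∈ phaseSpace Q, omega L u (P u) = 0)
    (hE : ∀ u ∈ phaseSpace Q, fderiv ℝ (energy L) u (P u) = 0)
    {u : Phase D} (hu : u ∈ constraintSet Q L) (s : ℝ) : Φ s u ∈ constraintSet Q L := by
  refine ⟨hΦ.mem hu.1 s, fun K hK => ?_⟩
  have hs : Φ (-s) (Φ s u) = u := hΦ.neg_apply hP hu.1 s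
  have hKe : fderiv ℝ (Φ s) u (fderiv ℝ (Φ (-s)) (Φ s u) K) = K := by
    have := hΦ.fderiv_apply_neg hP (hΦ.mem hu.1 s) s K
    rwa [hs] at this
  rw [← hKe, hΦ.fderiv_energy hL hE hu.1]
  refine hu.2 _ (ContinuousLinearMap.ext fun y => ?_)
  rw [← hΦ.omega_fderiv hL hP hk hu.1 s, hKe, hK]
  rfl

end IsFlow

/-- The linear map that governs the evolution of the gauge component along the flow of `P` has the
gauge directions in its kernel; this expresses `[P, 𝒢] ⊆ 𝒢` through the projection `N`. -/
theorem IsGaugeProjection.transport_apply (hL : ContDiffOn ℝ ∞ L (phaseSpace Q)) {P : VF D}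
    (hP : P ∈ kerBar Q L) {N : Phase D → Phase D →L[ℝ] Phase D} (hN : IsGaugeProjection Q L N)
    {u : Phase D} (hu : u ∈ phaseSpace Q) (x : Phase D) :
    fderiv ℝ P u (N u x) - N u (fderiv ℝ P u (N u x)) - fderiv ℝ N u (P u) (N u x) = 0 := by
  have hself : ∀ u ∈ phaseSpace Q, ∀ v : Phase D, v.1 = 0 → hessian L u v.2 = 0 → N u v = v :=
    fun u hu v h1 h2 => by
      have hv : v = (0, v.2) := Prod.ext h1 rfl
      rw [hv]
      exact hN.apply_eq_self u hu v.2 h2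
  have hNd := (diffAt hN.smooth hu).hasFDerivAt
  -- The derivative of `N ∘ N = N`.
  have h1 : fderiv ℝ N u (P u) (N u x) + N u (fderiv ℝ N u (P u) x) = fderiv ℝ N u (P u) x := by
    have e1 := (hNd.clm_apply (hNd.clm_apply (hasFDerivAt_const x u))).fderiv
    have e2 := (hNd.clm_apply (hasFDerivAt_const x u)).fderiv
    have e3 : (fun u => N u (N u x)) =ᶠ[𝓝 u] fun u => N u x :=
      (eventually_mem_phaseSpace hu).mono fun u' hu' =>
        hself u' hu' _ (hN.fst_eq_zero u' hu' x) (hN.hessian_eq_zero u' hu' x)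
    have e4 := congrArg (fun φ : Phase D →L[ℝ] Phase D => φ (P u))
      (e1.symm.trans (e3.fderiv_eq.trans e2))
    simpa [add_comm] using e4
  -- The bracket of `P` with the gauge field `N · x` is fixed by `N`.
  have h2 := (lieBracket_mem_gauge hL hP (hN.apply_mem_gauge x)).2 u hu
  have h3 := hself u hu _ h2.1 h2.2
  have e2 := (hNd.clm_apply (hasFDerivAt_const x u)).fderiv
  have h4 : VectorField.lieBracket ℝ P (fun u => N u x) u =
      fderiv ℝ N u (P u) x - fderiv ℝ P u (N u x) := by
    rw [VectorField.lieBracket, e2]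
    simp
  rw [h4, map_sub] at h3
  have h5 : N u (fderiv ℝ N u (P u) x) = fderiv ℝ N u (P u) x - fderiv ℝ N u (P u) (N u x) := by
    exact eq_sub_of_add_eq' h1
  rw [h5] at h3
  have h6 : fderiv ℝ P u (N u x) - N u (fderiv ℝ P u (N u x)) - fderiv ℝ N u (P u) (N u x) =
      (fderiv ℝ N u (P u) x - fderiv ℝ N u (P u) (N u x) - N u (fderiv ℝ P u (N u x))) -
      (fderiv ℝ N u (P u) x - fderiv ℝ P u (N u x)) := by abel
  rw [h6, h3, sub_self]

namespace IsFlow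

variable {P : VF D} {Φ : ℝ → Phase D → Phase D}

/-- The flow of a vector field in `kerBar` preserves the gauge directions. -/
theorem fderiv_gauge (hΦ : IsFlow Q P Φ) (hL : ContDiffOn ℝ ∞ L (phaseSpace Q))
    (hM : HessianConstantRank Q L) (hP : P ∈ kerBar Q L) {u : Phase D} (hu : u ∈ phaseSpace Q)
    (s : ℝ) {z : Config D} (hz : hessian L u z = 0) :
    (fderiv ℝ (Φ s) u (0, z)).1 = 0 ∧ hessian L (Φ s u) (fderiv ℝ (Φ s) u (0, z)).2 = 0 := by
  obtain ⟨N, hN⟩ := exists_gaugeProjection hL hM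
  set k : ℝ → Phase D := fun s => fderiv ℝ (Φ s) u (0, z) with hk
  set W : Phase D → Phase D →L[ℝ] Phase D := fun u =>
    fderiv ℝ P u - N u ∘L fderiv ℝ P u - fderiv ℝ N u (P u) with hW
  have hkd : ∀ s, HasDerivAt k (fderiv ℝ P (Φ s u) (k s)) s := hΦ.hasDerivAt_fderiv hP.1 hu (0, z)
  have hNd : ∀ s, HasDerivAt (fun s => N (Φ s u)) (fderiv ℝ N (Φ s u) (P (Φ s u))) s := fun s =>
    (diffAt hN.smooth (hΦ.mem hu s)).hasFDerivAt.comp_hasDerivAt s (hΦ.hasDerivAt hu s)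
  have hWs : ContDiffOn ℝ ∞ W (phaseSpace Q) :=
    ((smooth_fderiv hP.1).sub (hN.smooth.clm_comp (smooth_fderiv hP.1))).sub
      ((smooth_fderiv hN.smooth).clm_apply hP.1)
  have h0 : ∀ s, k s - N (Φ s u) (k s) = 0 := by
    refine eq_zero_of_norm_deriv_le_real (N' := fun s => W (Φ s u) (k s - N (Φ s u) (k s)))
      (w := fun s => ‖W (Φ s u)‖) (fun s => ?_) ?_ (fun s => ?_) ?_
    · have h1 := (hkd s).sub ((hNd s).clm_apply (hkd s))
      have h2 := hN.transport_apply hL hP (hΦ.mem hu s) (k s)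
      have h3 : W (Φ s u) (k s - N (Φ s u) (k s)) = fderiv ℝ P (Φ s u) (k s) -
          (fderiv ℝ N (Φ s u) (P (Φ s u)) (k s) + N (Φ s u) (fderiv ℝ P (Φ s u) (k s))) := by
        have h4 : W (Φ s u) (N (Φ s u) (k s)) = 0 := h2
        rw [map_sub, h4, sub_zero]
        simp only [hW, sub_apply, ContinuousLinearMap.comp_apply]
        abel
      rw [h3]
      exact h1
    · refine (continuous_iff_continuousAt.2 fun s => ?_).norm
      exact ContinuousAt.comp (f := fun s => Φ s u) (diffAt hWs (hΦ.mem hu s)).continuousAt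
        (hΦ.hasDerivAt hu s).continuousAt
    · exact ContinuousLinearMap.le_opNorm _ _
    · simp only [hk]
      rw [hΦ.fderiv_zero hu, hΦ.zero_apply hu, hN.apply_eq_self u hu z hz, sub_self]
  have hs : fderiv ℝ (Φ s) u (0, z) = N (Φ s u) (k s) := sub_eq_zero.1 (h0 s)
  rw [hs]
  exact ⟨hN.fst_eq_zero _ (hΦ.mem hu s) _, hN.hessian_eq_zero _ (hΦ.mem hu s) _⟩

end IsFlow

/-- The push-forward of a vector field along the flow `Φ` at time `s`; the inverse of `Φ s` is
written as `Φ (-s)`. -/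
def pushforward (Φ : ℝ → Phase D → Phase D) (s : ℝ) (X : VF D) : VF D := fun u =>
  fderiv ℝ (Φ s) (Φ (-s) u) (X (Φ (-s) u))

namespace IsFlow

variable {P : VF D} {Φ : ℝ → Phase D → Phase D}

theorem smooth_pushforward (hΦ : IsFlow Q P Φ) {X : VF D} (hX : ContDiffOn ℝ ∞ X (phaseSpace Q))
    (s : ℝ) : ContDiffOn ℝ ∞ (pushforward Φ s X) (phaseSpace Q) := by
  have hm : MapsTo (Φ (-s)) (phaseSpace Q) (phaseSpace Q) := fun u hu => hΦ.mem hu (-s)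
  exact ((smooth_fderiv (hΦ.smooth s)).comp (hΦ.smooth (-s)) hm).clm_apply
    (hX.comp (hΦ.smooth (-s)) hm)

theorem pushforward_apply (hΦ : IsFlow Q P Φ) (hP : ContDiffOn ℝ ∞ P (phaseSpace Q)) (X : VF D)
    {u : Phase D} (hu : u ∈ phaseSpace Q) (s : ℝ) :
    pushforward Φ s X (Φ s u) = fderiv ℝ (Φ s) u (X u) := by
  rw [pushforward, hΦ.neg_apply hP hu]

theorem pushforward_mem_gauge (hΦ : IsFlow Q P Φ) (hL : ContDiffOn ℝ ∞ L (phaseSpace Q))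
    (hM : HessianConstantRank Q L) (hP : P ∈ kerBar Q L) {G : VF D} (hG : G ∈ gauge Q L) (s : ℝ) :
    pushforward Φ s G ∈ gauge Q L := by
  refine ⟨hΦ.smooth_pushforward hG.1 s, fun u hu => ?_⟩
  have hu' := hΦ.mem hu (-s)
  obtain ⟨h1, h2⟩ := hG.2 _ hu'
  have h3 : G (Φ (-s) u) = (0, (G (Φ (-s) u)).2) := Prod.ext h1 rfl
  have h4 := hΦ.fderiv_gauge hL hM hP hu' s h2
  rw [hΦ.apply_neg hP.1 hu, ← h3] at h4
  exact h4

theorem pullback_eq_pushforward (hΦ : IsFlow Q P Φ) (hP : ContDiffOn ℝ ∞ P (phaseSpace Q))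
    (X : VF D) {u : Phase D} (hu : u ∈ phaseSpace Q) (s : ℝ) :
    VectorField.pullback ℝ (Φ (-s)) X u = pushforward Φ s X u := by
  have h : (fderiv ℝ (Φ (-s)) u).inverse = fderiv ℝ (Φ s) (Φ (-s) u) := by
    refine ContinuousLinearMap.inverse_eq (ContinuousLinearMap.ext fun x => ?_)
      (ContinuousLinearMap.ext fun x => hΦ.fderiv_apply_neg hP hu s x)
    have := hΦ.fderiv_neg_apply hP (hΦ.mem hu (-s)) s x
    rwa [hΦ.apply_neg hP hu s] at this
  rw [VectorField.pullback, h, pushforward]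

theorem pushforward_pushforward_neg (hΦ : IsFlow Q P Φ) (hP : ContDiffOn ℝ ∞ P (phaseSpace Q))
    (X : VF D) {u : Phase D} (hu : u ∈ phaseSpace Q) (s : ℝ) :
    pushforward Φ s (pushforward Φ (-s) X) u = X u := by
  have h := hΦ.pushforward_apply hP X hu (-s)
  rw [pushforward, h, hΦ.fderiv_apply_neg hP hu]

theorem pushforward_lieBracket (hΦ : IsFlow Q P Φ) (hP : ContDiffOn ℝ ∞ P (phaseSpace Q))
    {X Y : VF D} (hX : ContDiffOn ℝ ∞ X (phaseSpace Q)) (hY : ContDiffOn ℝ ∞ Y (phaseSpace Q))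
    {u : Phase D} (hu : u ∈ phaseSpace Q) (s : ℝ) :
    pushforward Φ s (VectorField.lieBracket ℝ X Y) u =
      VectorField.lieBracket ℝ (pushforward Φ s X) (pushforward Φ s Y) u := by
  have hev : ∀ X : VF D, VectorField.pullback ℝ (Φ (-s)) X =ᶠ[𝓝 u] pushforward Φ s X := fun X =>
    (eventually_mem_phaseSpace hu).mono fun u' hu' => hΦ.pullback_eq_pushforward hP X hu' s
  rw [← hΦ.pullback_eq_pushforward hP _ hu, VectorField.pullback_lieBracket (n := ∞)
    (by simpa using two_le_smooth) (smoothAt (hΦ.smooth (-s)) hu) (diffAt hX (hΦ.mem hu (-s)))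
    (diffAt hY (hΦ.mem hu (-s))), (hev X).lieBracket_vectorField_eq (hev Y)]

/-- The flow of a symmetry carries second-order Euler-Lagrange vector fields to such fields. -/
theorem pushforward_mem_solBar (hΦ : IsFlow Q P Φ) (hL : ContDiffOn ℝ ∞ L (phaseSpace Q))
    (hM : HessianConstantRank Q L) (hΩ : OmegaConstantRank Q L) (hP : P ∈ kerBar Q L)
    (hE : ∀ u ∈ phaseSpace Q, fderiv ℝ (energy L) u (P u) = 0) {X : VF D} (hX : X ∈ solBar Q L)
    (s : ℝ) : pushforward Φ s X ∈ solBar Q L := by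
  refine ⟨⟨hΦ.smooth_pushforward hX.1.1 s, fun u hu => ContinuousLinearMap.ext fun y => ?_⟩,
    fun G hG u hu => ?_⟩
  · have hu' := hΦ.mem_constraintSet hL hP.1 hP.2.1 hE hu (-s)
    have hy := hΦ.fderiv_apply_neg hP.1 hu.1 s y
    have h1 := hΦ.omega_fderiv hL hP.1 hP.2.1 hu'.1 s (X (Φ (-s) u)) (fderiv ℝ (Φ (-s)) u y)
    rw [hy, hX.1.2 _ hu', hΦ.fderiv_energy hL hE hu.1, hΦ.apply_neg hP.1 hu.1] at h1
    exact h1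
  · -- `[G, Φ_* X] = Φ_* [Φ^* G, X]`, and `[Φ^* G, X]` is a gauge vector on the constraint set.
    have hG' := hΦ.pushforward_mem_gauge hL hM hP hG (-s)
    set G' := pushforward Φ (-s) G with hGdef
    have hu' := hΦ.mem_constraintSet hL hP.1 hP.2.1 hE hu (-s)
    have hev : pushforward Φ s G' =ᶠ[𝓝 u] G := (eventually_mem_phaseSpace hu.1).mono fun u' hu' =>
      hΦ.pushforward_pushforward_neg hP.1 G hu' s
    have h1 := hΦ.pushforward_lieBracket hP.1 hG'.1 hX.1.1 hu.1 s
    rw [hev.lieBracket_vectorField_eq Filter.EventuallyEq.rfl] at h1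
    rw [← h1]
    have h2 := hX.2 G' hG' _ hu'
    have h3 := omega_lieBracket_sol hL hΩ hG'.1 (fun u hu => gauge_omega hL hG' hu)
      (fun u hu => fderiv_energy_gauge hL hG' hu) hX.1 hu'
    have h4 := (omega_vertical_eq_zero_iff hL hu'.1 h2).1 h3
    have h5 := (hΦ.fderiv_gauge hL hM hP hu'.1 s h4).1
    have h6 : VectorField.lieBracket ℝ G' X (Φ (-s) u) =
      (0, (VectorField.lieBracket ℝ G' X (Φ (-s) u)).2) := Prod.ext h2 rfl
    rw [← h6] at h5
    exact h5

end IsFlow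

/-! ### Invariance of the action under flows -/

/-- The derivative of the function `θ_L(P)` at `u` in the direction `x`. -/
def thetaVariation (L : Phase D → ℝ) (P : VF D) (u x : Phase D) : ℝ :=
  fderiv ℝ (theta L) u x (P u) + theta L u (fderiv ℝ P u x)

namespace IsFlow

variable {P : VF D} {Φ : ℝ → Phase D → Phase D} {w : ℝ → Phase D}

theorem contDiff_flow_comp (hΦ : IsFlow Q P Φ) (hw : ContDiff ℝ ∞ w)
    (hm : ∀ t, w t ∈ phaseSpace Q) : ContDiff ℝ ∞ fun p : ℝ × ℝ => Φ p.1 (w p.2) :=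
  hΦ.1.comp_contDiff (contDiff_fst.prodMk (hw.comp contDiff_snd)) fun p => ⟨mem_univ _, hm p.2⟩

theorem continuous_fderiv_flow_comp (hΦ : IsFlow Q P Φ) (hw : ContDiff ℝ ∞ w)
    (hm : ∀ t, w t ∈ phaseSpace Q) :
    Continuous fun p : ℝ × ℝ => fderiv ℝ (Φ p.1) (w p.2) (deriv w p.2) := by
  have hc : ContDiff ℝ ∞ fun p : ℝ × ℝ => (p.1, w p.2) :=
    contDiff_fst.prodMk (hw.comp contDiff_snd)
  have h1 := (contDiffOn_fderiv (isOpen_univ.prod (isOpen_phaseSpace Q)) hΦ.1).comp_contDiff hc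
    fun p => ⟨mem_univ _, hm p.2⟩
  have h2 : Continuous fun p : ℝ × ℝ => ((0 : ℝ), deriv w p.2) :=
    continuous_const.prodMk ((contDiff_deriv hw).continuous.comp continuous_snd)
  have h3 := h1.continuous.clm_apply h2
  refine h3.congr fun p => ?_
  exact (hΦ.fderiv_eq_uncurry (hm p.2) p.1 _).symm

theorem hasDerivAt_comp (hΦ : IsFlow Q P Φ) (hw : ContDiff ℝ ∞ w)
    (hm : ∀ t, w t ∈ phaseSpace Q) (s t : ℝ) :
    HasDerivAt (fun t => Φ s (w t)) (fderiv ℝ (Φ s) (w t) (deriv w t)) t :=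
  (diffAt (hΦ.smooth s) (hm t)).hasFDerivAt.comp_hasDerivAt t
    (hw.differentiable (by simp) t).hasDerivAt

theorem hasDerivAt_theta_flow (hΦ : IsFlow Q P Φ) (hL : ContDiffOn ℝ ∞ L (phaseSpace Q))
    (hP : ContDiffOn ℝ ∞ P (phaseSpace Q)) (hw : ContDiff ℝ ∞ w)
    (hm : ∀ t, w t ∈ phaseSpace Q) (s t : ℝ) :
    HasDerivAt (fun t => theta L (Φ s (w t)) (P (Φ s (w t))))
      (thetaVariation L P (Φ s (w t)) (fderiv ℝ (Φ s) (w t) (deriv w t))) t := by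
  have h := hΦ.hasDerivAt_comp hw hm s t
  have hmem := hΦ.mem (hm t) s
  have h1 := HasFDerivAt.comp_hasDerivAt (f := fun t => Φ s (w t)) t
    (diffAt (smooth_theta hL) hmem).hasFDerivAt h
  have h2 := HasFDerivAt.comp_hasDerivAt (f := fun t => Φ s (w t)) t
    (diffAt hP hmem).hasFDerivAt h
  exact h1.clm_apply h2

/-- The change of `θ_L` along the flow of `P` is exact: `𝔏_P θ_L = d (θ_L(P)) - i_P Ω_L`, where
`i_P Ω_L = 0`. -/
theorem hasDerivAt_theta_fderiv (hΦ : IsFlow Q P Φ) (hL : ContDiffOn ℝ ∞ L (phaseSpace Q))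
    (hP : ContDiffOn ℝ ∞ P (phaseSpace Q)) (hk : ∀ u ∈ phaseSpace Q, omega L u (P u) = 0)
    {u : Phase D} (hu : u ∈ phaseSpace Q) (x : Phase D) (s : ℝ) :
    HasDerivAt (fun s => theta L (Φ s u) (fderiv ℝ (Φ s) u x))
      (thetaVariation L P (Φ s u) (fderiv ℝ (Φ s) u x)) s := by
  have hmem := hΦ.mem hu s
  have h1 := HasFDerivAt.comp_hasDerivAt (f := fun s => Φ s u) s
    (diffAt (smooth_theta hL) hmem).hasFDerivAt (hΦ.hasDerivAt hu s)
  refine (h1.clm_apply (hΦ.hasDerivAt_fderiv hP hu x s)).congr_deriv ?_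
  have h2 : omega L (Φ s u) (P (Φ s u)) (fderiv ℝ (Φ s) u x) = 0 := by
    rw [hk _ hmem]; rfl
  rw [omega_apply, sub_eq_zero] at h2
  rw [thetaVariation, h2]
  rfl

theorem continuous_thetaVariation (hΦ : IsFlow Q P Φ) (hL : ContDiffOn ℝ ∞ L (phaseSpace Q))
    (hP : ContDiffOn ℝ ∞ P (phaseSpace Q)) (hw : ContDiff ℝ ∞ w)
    (hm : ∀ t, w t ∈ phaseSpace Q) :
    Continuous fun p : ℝ × ℝ =>
      thetaVariation L P (Φ p.1 (w p.2)) (fderiv ℝ (Φ p.1) (w p.2) (deriv w p.2)) := by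
  have hc := (hΦ.contDiff_flow_comp hw hm).continuous
  have hd := hΦ.continuous_fderiv_flow_comp hw hm
  have hmem : ∀ p : ℝ × ℝ, Φ p.1 (w p.2) ∈ phaseSpace Q := fun p => hΦ.mem (hm p.2) p.1
  have comp : ∀ {F : Type} [NormedAddCommGroup F] [NormedSpace ℝ F] {g : Phase D → F},
      ContDiffOn ℝ ∞ g (phaseSpace Q) → Continuous fun p : ℝ × ℝ => g (Φ p.1 (w p.2)) :=
    fun hg => hg.continuousOn.comp_continuous hc hmem
  exact (((comp (smooth_fderiv (smooth_theta hL))).clm_apply hd).clm_apply (comp hP)).add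
    ((comp (smooth_theta hL)).clm_apply ((comp (smooth_fderiv hP)).clm_apply hd))

/-- The flow of a vector field `P` in the kernel of `Ω_L` with `P E = 0` changes the action by the
end point terms of the function `∫₀^ε θ_L(P) ∘ Φ_s ds`. -/
theorem phaseAction_comp (hΦ : IsFlow Q P Φ) (hL : ContDiffOn ℝ ∞ L (phaseSpace Q))
    (hP : ContDiffOn ℝ ∞ P (phaseSpace Q)) (hk : ∀ u ∈ phaseSpace Q, omega L u (P u) = 0)
    (hE : ∀ u ∈ phaseSpace Q, fderiv ℝ (energy L) u (P u) = 0) (hw : ContDiff ℝ ∞ w)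
    (hm : ∀ t, w t ∈ phaseSpace Q) (t₁ t₂ ε : ℝ) :
    phaseAction L t₁ t₂ (fun t => Φ ε (w t)) = phaseAction L t₁ t₂ w +
      ((∫ s in (0 : ℝ)..ε, theta L (Φ s (w t₂)) (P (Φ s (w t₂)))) -
        ∫ s in (0 : ℝ)..ε, theta L (Φ s (w t₁)) (P (Φ s (w t₁)))) := by
  set a : ℝ → ℝ → ℝ := fun s t => theta L (Φ s (w t)) (fderiv ℝ (Φ s) (w t) (deriv w t)) with ha
  set β : ℝ → ℝ → ℝ := fun s t =>
    thetaVariation L P (Φ s (w t)) (fderiv ℝ (Φ s) (w t) (deriv w t)) with hβ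
  have hβc : Continuous (Function.uncurry β) := hΦ.continuous_thetaVariation hL hP hw hm
  have hβs : ∀ t, Continuous fun s => β s t := fun t =>
    hβc.comp (continuous_id.prodMk continuous_const)
  have hβt : ∀ s, Continuous fun t => β s t := fun s =>
    hβc.comp (continuous_const.prodMk continuous_id)
  have hac : ∀ s, Continuous fun t => a s t := fun s => by
    have h1 : Continuous fun t => Φ s (w t) :=
      (hΦ.contDiff_flow_comp hw hm).continuous.comp
        (continuous_const.prodMk continuous_id : Continuous fun t : ℝ => (s, t))
    have h2 : Continuous fun t => fderiv ℝ (Φ s) (w t) (deriv w t) :=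
      (hΦ.continuous_fderiv_flow_comp hw hm).comp
        (continuous_const.prodMk continuous_id : Continuous fun t : ℝ => (s, t))
    exact ((smooth_theta hL).continuousOn.comp_continuous h1 fun t => hΦ.mem (hm t) s).clm_apply h2
  have hbc : ∀ t, Continuous fun s => theta L (Φ s (w t)) (P (Φ s (w t))) := fun t => by
    have h1 : Continuous fun s => Φ s (w t) :=
      continuous_iff_continuousAt.2 fun s => (hΦ.hasDerivAt (hm t) s).continuousAt
    exact ((smooth_theta hL).continuousOn.comp_continuous h1 fun s => hΦ.mem (hm t) s).clm_apply
      (hP.continuousOn.comp_continuous h1 fun s => hΦ.mem (hm t) s)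
  have hEc : Continuous fun t => energy L (w t) :=
    (smooth_energy hL).continuousOn.comp_continuous hw.continuous hm
  have ha0 : ∀ t, a 0 t = theta L (w t) (deriv w t) := fun t => by
    simp only [ha]
    rw [hΦ.fderiv_zero (hm t), hΦ.zero_apply (hm t)]
  have h1 : phaseAction L t₁ t₂ (fun t => Φ ε (w t)) =
      ∫ t in t₁..t₂, ((theta L (w t) (deriv w t) - energy L (w t)) + (a ε t - a 0 t)) := by
    refine intervalIntegral.integral_congr fun t _ => ?_
    simp only
    rw [(hΦ.hasDerivAt_comp hw hm ε t).deriv, hΦ.energy_apply hL hE (hm t), ha0]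
    simp only [ha]
    ring
  have h2 : ∀ t, a ε t - a 0 t = ∫ s in (0 : ℝ)..ε, β s t := fun t =>
    (intervalIntegral.integral_eq_sub_of_hasDerivAt
      (fun s _ => hΦ.hasDerivAt_theta_fderiv hL hP hk (hm t) (deriv w t) s)
      ((hβs t).intervalIntegrable _ _)).symm
  have h3 : ∫ t in t₁..t₂, (a ε t - a 0 t) = ∫ s in (0 : ℝ)..ε, ∫ t in t₁..t₂, β s t := by
    simp only [h2]
    refine (intervalIntegral_intervalIntegral_swap ?_).symm
    exact (hβc.continuousOn.integrableOn_compact (isCompact_uIcc.prod isCompact_uIcc)).mono_set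
      (prod_mono uIoc_subset_uIcc uIoc_subset_uIcc)
  have h4 : ∀ s, ∫ t in t₁..t₂, β s t =
      theta L (Φ s (w t₂)) (P (Φ s (w t₂))) - theta L (Φ s (w t₁)) (P (Φ s (w t₁))) := fun s =>
    intervalIntegral.integral_eq_sub_of_hasDerivAt
      (fun t _ => hΦ.hasDerivAt_theta_flow hL hP hw hm s t) ((hβt s).intervalIntegrable _ _)
  have hint : Continuous fun t => theta L (w t) (deriv w t) - energy L (w t) := by
    have h : Continuous fun t => a 0 t - energy L (w t) := (hac 0).sub hEc
    simpa only [ha0] using h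
  have hdiff : Continuous fun t => a ε t - a 0 t := (hac ε).sub (hac 0)
  rw [h1, intervalIntegral.integral_add (hint.intervalIntegrable _ _)
    (hdiff.intervalIntegrable _ _), h3]
  simp only [h4]
  rw [intervalIntegral.integral_sub ((hbc t₂).intervalIntegrable _ _)
    ((hbc t₁).intervalIntegrable _ _)]
  rfl

end IsFlow

/-! ### The groups generated by flows -/

/-- Induction over the group generated by flows. The inverse of a flow map is again a flow map, so
that no condition on inverses is needed. -/
theorem flowGroup_induction {S : Set (VF D)} (hS : ∀ P ∈ S, ContDiffOn ℝ ∞ P (phaseSpace Q))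
    {p : Equiv.Perm (phaseSpace Q) → Prop}
    (flow : ∀ P ∈ S, ∀ Φ, IsFlow Q P Φ → ∀ (ε : ℝ) (σ : Equiv.Perm (phaseSpace Q)),
      (∀ u : phaseSpace Q, (σ u : Phase D) = Φ ε u) → p σ)
    (one : p 1) (mul : ∀ σ τ, p σ → p τ → p (σ * τ)) {σ : Equiv.Perm (phaseSpace Q)}
    (hσ : σ ∈ flowGroup Q S) : p σ := by
  suffices h : p σ ∧ p σ⁻¹ from h.1
  induction hσ using Subgroup.closure_induction with
  | mem σ hσ =>
    obtain ⟨P, hP, Φ, hΦ, ε, h⟩ := hσ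
    refine ⟨flow P hP Φ hΦ ε σ h, flow P hP Φ hΦ (-ε) σ⁻¹ fun u => ?_⟩
    have h1 := h (σ⁻¹ u)
    rw [show σ (σ⁻¹ u) = u from σ.apply_symm_apply u] at h1
    rw [h1, hΦ.neg_apply (hS P hP) (σ⁻¹ u).2]
  | one => exact ⟨one, by rwa [inv_one]⟩
  | mul σ τ _ _ hσ hτ => exact ⟨mul _ _ hσ.1 hτ.1, by rw [mul_inv_rev]; exact mul _ _ hτ.2 hσ.2⟩
  | inv σ _ hσ => exact ⟨hσ.2, by rw [inv_inv]; exact hσ.1⟩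

theorem smooth_of_mem_representatives {S : Set (KerBarQuot Q L)} :
    ∀ P ∈ representatives S, ContDiffOn ℝ ∞ P (phaseSpace Q) := fun _ hP => hP.1.1

theorem exists_phaseAction_eq (hL : ContDiffOn ℝ ∞ L (phaseSpace Q)) (t₁ t₂ : ℝ)
    {σ : Equiv.Perm (phaseSpace Q)} (hσ : σ ∈ grSymL Q L) :
    ∃ f : phaseSpace Q → ℝ, ∀ w : ℝ → phaseSpace Q, ContDiff ℝ ∞ (fun t => (w t : Phase D)) →
      phaseAction L t₁ t₂ (fun t => (σ (w t) : Phase D)) =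
        phaseAction L t₁ t₂ (fun t => (w t : Phase D)) + (f (w t₂) - f (w t₁)) := by
  -- The induction also needs that `σ` preserves smoothness of paths.
  suffices h : (∀ w : ℝ → phaseSpace Q, ContDiff ℝ ∞ (fun t => (w t : Phase D)) →
      ContDiff ℝ ∞ fun t => (σ (w t) : Phase D)) ∧ _ from h.2
  refine flowGroup_induction (p := fun σ : Equiv.Perm (phaseSpace Q) =>
    (∀ w : ℝ → phaseSpace Q, ContDiff ℝ ∞ (fun t => (w t : Phase D)) →
      ContDiff ℝ ∞ fun t => (σ (w t) : Phase D)) ∧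
    ∃ f : phaseSpace Q → ℝ, ∀ w : ℝ → phaseSpace Q, ContDiff ℝ ∞ (fun t => (w t : Phase D)) →
      phaseAction L t₁ t₂ (fun t => (σ (w t) : Phase D)) =
        phaseAction L t₁ t₂ (fun t => (w t : Phase D)) + (f (w t₂) - f (w t₁)))
    smooth_of_mem_representatives ?_ ?_ ?_ hσ
  · intro P hP Φ hΦ ε σ h
    obtain ⟨hP, hE⟩ := (mem_representatives_symL_iff hL).1 hP
    simp only [h]
    exact ⟨fun w hw => (hΦ.smooth ε).comp_contDiff hw fun t => (w t).2,
      fun u => ∫ s in (0 : ℝ)..ε, theta L (Φ s u) (P (Φ s u)), fun w hw =>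
        hΦ.phaseAction_comp hL hP.1 hP.2.1 hE hw (fun t => (w t).2) t₁ t₂ ε⟩
  · exact ⟨fun w hw => hw, 0, fun w _ => by simp⟩
  · rintro σ τ ⟨hσ, f, hf⟩ ⟨hτ, g, hg⟩
    refine ⟨fun w hw => hσ (fun t => τ (w t)) (hτ w hw), fun u => g u + f (τ u), fun w hw => ?_⟩
    have h1 := hf (fun t => τ (w t)) (hτ w hw)
    rw [hg w hw] at h1
    simp only [Equiv.Perm.mul_apply]
    rw [h1]
    ring

/-- Composition with the flow maps solutions of `ċ = X(c)` to solutions for the push-forward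
of `X`. -/
theorem IsFlow.map_orbitsEL {P : VF D} {Φ : ℝ → Phase D → Phase D} (hΦ : IsFlow Q P Φ)
    (hL : ContDiffOn ℝ ∞ L (phaseSpace Q)) (hM : HessianConstantRank Q L)
    (hΩ : OmegaConstantRank Q L) (hP : P ∈ kerBar Q L)
    (hE : ∀ u ∈ phaseSpace Q, fderiv ℝ (energy L) u (P u) = 0) (ε : ℝ)
    {σ : Equiv.Perm (phaseSpace Q)} (h : ∀ u : phaseSpace Q, (σ u : Phase D) = Φ ε u) {t₀ : ℝ}
    {u₀ : phaseSpace Q} {c : ℝ → phaseSpace Q} (hc : c ∈ orbitsEL Q L t₀ u₀) :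
    (fun t => σ (c t)) ∈ orbitsEL Q L t₀ (σ u₀) := by
  obtain ⟨hc0, X, hX, hcX⟩ := hc
  refine ⟨congrArg σ hc0, pushforward Φ ε X,
    hΦ.pushforward_mem_solBar hL hM hΩ hP hE hX ε, fun t ht => ?_⟩
  simp only [h]
  rw [hΦ.pushforward_apply hP.1 X (c t).2]
  exact (diffAt (hΦ.smooth ε) (c t).2).hasFDerivAt.comp_hasDerivWithinAt t (hcX t ht)

theorem image_orbitsEL (hL : ContDiffOn ℝ ∞ L (phaseSpace Q)) (hM : HessianConstantRank Q L)
    (hΩ : OmegaConstantRank Q L) {σ : Equiv.Perm (phaseSpace Q)} (hσ : σ ∈ grSymL Q L) (t₀ : ℝ)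
    (u₀ : phaseSpace Q) :
    (fun c : ℝ → phaseSpace Q => fun t => σ (c t)) '' orbitsEL Q L t₀ u₀ =
      orbitsEL Q L t₀ (σ u₀) := by
  have key : ∀ σ ∈ grSymL Q L, ∀ (u₀ : phaseSpace Q), ∀ c ∈ orbitsEL Q L t₀ u₀,
      (fun t => σ (c t)) ∈ orbitsEL Q L t₀ (σ u₀) := by
    intro σ hσ
    refine flowGroup_induction (p := fun σ : Equiv.Perm (phaseSpace Q) =>
      ∀ (u₀ : phaseSpace Q), ∀ c ∈ orbitsEL Q L t₀ u₀,
        (fun t => σ (c t)) ∈ orbitsEL Q L t₀ (σ u₀)) smooth_of_mem_representatives ?_ ?_ ?_ hσ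
    · intro P hP Φ hΦ ε σ h u₀ c hc
      obtain ⟨hP, hE⟩ := (mem_representatives_symL_iff hL).1 hP
      exact hΦ.map_orbitsEL hL hM hΩ hP hE ε h hc
    · exact fun u₀ c hc => hc
    · exact fun σ τ hσ hτ u₀ c hc => hσ _ _ (hτ _ _ hc)
  refine Subset.antisymm ?_ fun c hc => ?_
  · rintro _ ⟨c, hc, rfl⟩
    exact key σ hσ u₀ c hc
  · refine ⟨fun t => σ⁻¹ (c t), ?_, funext fun t => σ.apply_symm_apply (c t)⟩
    have h := key σ⁻¹ (inv_mem hσ) (σ u₀) c hc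
    rwa [show σ⁻¹ (σ u₀) = u₀ from σ.symm_apply_apply u₀] at h

theorem grSymL_le_grSym (hL : ContDiffOn ℝ ∞ L (phaseSpace Q)) (hΩ : OmegaConstantRank Q L)
    {X : VF D} (hX : X ∈ sol Q L) : grSymL Q L ≤ grSym Q L X := by
  refine Subgroup.closure_mono ?_
  rintro σ ⟨P, ⟨hP, hc⟩, hσ⟩
  exact ⟨P, ⟨hP, symL_subset_sym hL hΩ hX hc⟩, hσ⟩

end LagrangianSymmetry

end

open LagrangianSymmetry in
theorem theorem3 (D : ℕ) (Q : TopologicalSpace.Opens (Config D)) (L : Phase D → ℝ)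
    (hL : ContDiffOn ℝ ∞ L (phaseSpace Q))
    (hM : HessianConstantRank Q L) (hΩ : OmegaConstantRank Q L)
    (t₁ t₂ : ℝ) (ht : t₁ < t₂) :
    -- `SymL` is a Lie algebra: the Lie bracket descends to classes and preserves `SymL`
    (gauge Q L ≤ kerBar Q L ∧
      (∀ P ∈ kerBar Q L, ∀ G ∈ gauge Q L, VectorField.lieBracket ℝ P G ∈ gauge Q L) ∧
      (∀ P₁ ∈ representatives (symL Q L : Set (KerBarQuot Q L)),
        ∀ P₂ ∈ representatives (symL Q L : Set (KerBarQuot Q L)),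
          VectorField.lieBracket ℝ P₁ P₂ ∈
            representatives (symL Q L : Set (KerBarQuot Q L)))) ∧
    -- its elements are exactly the classes that generate a symmetry of the action
    (∀ (P : VF D) (hP : P ∈ kerBar Q L),
      cls P hP ∈ symL Q L ↔ IsActionSymmetry Q L t₁ t₂ (fun u => (P u).1)) ∧
    -- every symmetry of the action that is constant along `𝒢` comes from exactly one element
    (∀ ρ : Phase D → Config D, IsActionSymmetry Q L t₁ t₂ ρ →
      (∀ G ∈ gauge Q L, ∀ u ∈ phaseSpace Q, fderiv ℝ ρ u (G u) = 0) →
      ∃! c : KerBarQuot Q L, c ∈ symL Q L ∧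
        ∃ (P : VF D) (hP : P ∈ kerBar Q L), cls P hP = c ∧ ∀ u ∈ phaseSpace Q, (P u).1 = ρ u) ∧
    -- `Gr_SymL` is the group of symmetry transformations of the action
    grSymL Q L = actionSymmetryGroup Q L t₁ t₂ ∧
    -- its elements leave the action invariant, up to end point terms
    (∀ σ ∈ grSymL Q L, ∃ f : phaseSpace Q → ℝ, ∀ w : ℝ → phaseSpace Q,
      ContDiff ℝ ∞ (fun t => (w t : Phase D)) →
        phaseAction L t₁ t₂ (fun t => (σ (w t) : Phase D)) =
          phaseAction L t₁ t₂ (fun t => (w t : Phase D)) + (f (w t₂) - f (w t₁))) ∧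
    -- `Gr_SymL` is a Lie subgroup of `Gr_Sym`
    (∀ X ∈ sol Q L, (symL Q L : Set (KerBarQuot Q L)) ⊆ sym Q L X ∧
      grSymL Q L ≤ grSym Q L X) ∧
    -- `Gr_SymL` acts as a symmetry group of the family of Euler-Lagrange integral flows
    (∀ σ ∈ grSymL Q L, ∀ (t₀ : ℝ) (u₀ : phaseSpace Q),
      (fun c : ℝ → phaseSpace Q => fun t => σ (c t)) '' orbitsEL Q L t₀ u₀ =
        orbitsEL Q L t₀ (σ u₀)) := by
  exact ⟨⟨gauge_le_kerBar hL, fun _ hP _ hG => lieBracket_mem_gauge hL hP hG,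
      fun _ h₁ _ h₂ => lieBracket_mem_representatives_symL hL h₁ h₂⟩,
    fun _ hP => cls_mem_symL_iff_isActionSymmetry hL ht hP,
    fun _ hρ hG => existsUnique_class_of_isActionSymmetry hL hM ht hρ hG,
    grSymL_eq_actionSymmetryGroup hL ht,
    fun _ hσ => exists_phaseAction_eq hL t₁ t₂ hσ,
    fun _ hX => ⟨symL_subset_sym hL hΩ hX, grSymL_le_grSym hL hΩ hX⟩,
    fun _ hσ t₀ u₀ => image_orbitsEL hL hM hΩ hσ t₀ u₀⟩
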